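/- Fix integers $k,\ell$ with $k/2<\ell<k$. A $k$-uniform hypergraph $H=([n],\mathcal E)$ is a set $\mathcal E$ of $k$-element subsets (edges) of $[n]=\{1,\dots,n\}$; let $m=|\mathcal E|$ and let $p=m/\binom nk$ be its density. For $X\subseteq[n]$ with $|X|<k$ put $N_H(X)=\{Y\subseteq[n]:|Y|=k-|X|,\ X\cup Y\in\mathcal E\}$ and $d_H(X)=|N_H(X)|$. For $\epsilon>0$ consider the following properties, in which $S,S_1,S_2$ range over subsets of $[n]$: - $P_a$: $d_H(S)\ge\left\lceil(1-\epsilon)\binom{n-2(k-\ell)}{2\ell-k}p\right\rceil$ whenever $|S|=2(k-\ell)$; - $P_b$: $d_H(S)\ge\left\lceil(1-\epsilon)\binom{n-2\ell+k}{2(k-\ell)}p\right\rceil$ whenever $|S|=2\ell-k$; - $P_c$: $d_H(S)\le\left\lfloor(1+\epsilon)\binom{n-2k+2\ell-1}{2\ell-k-1}p\right\rfloor$ whenever $|S|=2(k-\ell)+1<k$ (no condition if $2\ell=k+1$); - $P_d$: $d_H(S)\le\left\lfloor(1+\epsilon)\binom{n-2\ell+k-1}{2(k-\ell)-1}p\right\rfloor$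 whenever $|S|=2\ell-k+1$; - $P_e$: $|N_H(S_1)\cap N_H(S_2)|\le\left\lfloor(1+\epsilon)\binom{n-2(2\ell-k)}{2(k-\ell)}p^2\right\rfloor$ whenever $|S_1|=|S_2|=2\ell-k$ and $S_1\cap S_2=\emptyset$; - $P_f$: $|N_H(S_1)\cap N_H(S_2)|\le\left\lfloor(1+\epsilon)\binom{n}{2\ell-k}p^2\right\rfloor$ whenever $|S_1|=|S_2|=2(k-\ell)$ and $|S_1\cap S_2|\in\{0,k-\ell\}$. Let $\ell\mid n$ and $\nu_\ell=n/\ell$. A type-$\ell$ Hamilton cycle of $H$ is a collection of $\nu_\ell$ edges of $H$ such that, for some cyclic order of $[n]$, every edge consists of $k$ consecutive vertices and $|E_{i-1}\setminus E_i|=\ell$ for every pair of consecutive edges $E_{i-1},E_i$ (in the natural cyclic ordering of the edges). Theorem. Let $n\to\infty$ through multiples of $\ell$, and for each such $n$ let $H$ be a $k$-uniform hypergraph on $[n]$ with $m$ edges and density $p$, and let $\epsilon>0$, where $H$, $m$, $p$ and $\epsilon$ may depend on $n$. Suppose that $\epsilon^5<1$, that $$\frac{\epsilon^5}{\log^3 n/(n^{1/2}p^2)}\to\infty\quad\text{as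 }n\to\infty,$$ and that $H$ satisfies $P_a,P_b,P_c,P_d,P_e,P_f$. Then, for all sufficiently large $n$, $H$ contains a collection of at least $(1-2\epsilon^{1/3})m/\nu_\ell$ pairwise edge-disjoint type-$\ell$ Hamilton cycles. -/

import Mathlib

open Filter Topology

namespace HypergraphPacking

/-! A `k`-uniform hypergraph on the vertex set `[n]` is given by its edge set
`E : Finset (Finset (Fin n))`, with `(E : Set (Finset (Fin n))).Sized k`. -/

/-- The density `p = m / (n choose k)` of a `k`-uniform hypergraph on `[n]` with `m` edges. -/
noncomputable def density (k : ℕ) {n : ℕ} (E : Finset (Finset (Fin n))) : ℝ :=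
  (E.card : ℝ) / (n.choose k : ℝ)

/-- The neighbourhood `N(X) = {Y : |Y| = k - |X|, X ∪ Y ∈ E}` of a set `X` of fewer than `k`
vertices. -/
def nbhd (k : ℕ) {n : ℕ} (E : Finset (Finset (Fin n))) (X : Finset (Fin n)) :
    Finset (Finset (Fin n)) :=
  (Finset.powersetCard (k - X.card) Finset.univ).filter (fun Y => X ∪ Y ∈ E)

/-- The degree `d(X) = |N(X)|`. -/
def deg (k : ℕ) {n : ℕ} (E : Finset (Finset (Fin n))) (X : Finset (Fin n)) : ℕ :=
  (nbhd k E X).card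

/-- The degree and co-degree conditions `P_a, …, P_f` with regularity parameter `ε`.
The degree of a set is defined only for sets of fewer than `k` vertices; the sets in `Pc` have
`2 * (k - ℓ) + 1 ≤ k` elements, with equality exactly when `2 * ℓ = k + 1`, and in that case `Pc`
is void.  The sets in the other conditions always have fewer than `k` elements. -/
structure PseudoRandom (k ℓ : ℕ) (ε : ℝ) {n : ℕ} (E : Finset (Finset (Fin n))) : Prop where
  Pa : ∀ S : Finset (Fin n), S.card = 2 * (k - ℓ) →
    ⌈(1 - ε) * ((n - 2 * (k - ℓ)).choose (2 * ℓ - k) : ℝ) * density k E⌉₊ ≤ deg k E S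
  Pb : ∀ S : Finset (Fin n), S.card = 2 * ℓ - k →
    ⌈(1 - ε) * ((n - (2 * ℓ - k)).choose (2 * (k - ℓ)) : ℝ) * density k E⌉₊ ≤ deg k E S
  Pc : ∀ S : Finset (Fin n), S.card = 2 * (k - ℓ) + 1 → S.card < k →
    deg k E S ≤
      ⌊(1 + ε) * ((n - (2 * (k - ℓ) + 1)).choose (2 * ℓ - k - 1) : ℝ) * density k E⌋₊
  Pd : ∀ S : Finset (Fin n), S.card = 2 * ℓ - k + 1 →
    deg k E S ≤
      ⌊(1 + ε) * ((n - (2 * ℓ - k + 1)).choose (2 * (k - ℓ) - 1) : ℝ) * density k E⌋₊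
  Pe : ∀ S₁ S₂ : Finset (Fin n), S₁.card = 2 * ℓ - k → S₂.card = 2 * ℓ - k → S₁ ∩ S₂ = ∅ →
    (nbhd k E S₁ ∩ nbhd k E S₂).card ≤
      ⌊(1 + ε) * ((n - 2 * (2 * ℓ - k)).choose (2 * (k - ℓ)) : ℝ) * density k E ^ 2⌋₊
  Pf : ∀ S₁ S₂ : Finset (Fin n), S₁.card = 2 * (k - ℓ) → S₂.card = 2 * (k - ℓ) →
    ((S₁ ∩ S₂).card = 0 ∨ (S₁ ∩ S₂).card = k - ℓ) →
    (nbhd k E S₁ ∩ nbhd k E S₂).card ≤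
      ⌊(1 + ε) * (n.choose (2 * ℓ - k) : ℝ) * density k E ^ 2⌋₊

/-- The set of `k` consecutive vertices, starting at position `s`, of the cyclic order `v` of
`[n]`. -/
def arc {n : ℕ} (v : ZMod n ≃ Fin n) (k : ℕ) (s : ZMod n) : Finset (Fin n) :=
  (Finset.range k).image (fun j : ℕ => v (s + (j : ZMod n)))

/-- `C` is (the edge set of) a type `ℓ` Hamilton cycle of the `k`-uniform hypergraph `E` on `[n]`,
where `ℓ ∣ n`: it consists of `n / ℓ` edges of `E` and, for some cyclic order of `[n]`, these are
arcs of `k` consecutive vertices, each starting `ℓ` places after the preceding one, with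
`|Eᵢ \ Eᵢ₊₁| = ℓ` for all cyclically consecutive edges `Eᵢ, Eᵢ₊₁`. -/
def IsHamiltonCycle (k ℓ : ℕ) {n : ℕ} (E C : Finset (Finset (Fin n))) : Prop :=
  C ⊆ E ∧ C.card = n / ℓ ∧
    ∃ v : ZMod n ≃ Fin n,
      C = (Finset.range (n / ℓ)).image (fun i : ℕ => arc v k ((i * ℓ : ℕ) : ZMod n)) ∧
      ∀ i < n / ℓ,
        (arc v k ((i * ℓ : ℕ) : ZMod n) \ arc v k (((i + 1) * ℓ : ℕ) : ZMod n)).card = ℓ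

end HypergraphPacking

open HypergraphPacking

/-! Put a = k - ℓ, b = 2ℓ - k and ν = n/ℓ, so that ℓ = a + b and k = 2a + b. Cut an ordering of the
vertices into ν intervals of length ℓ, each consisting of a head of a vertices and a body of b
vertices. A link (two cyclically consecutive heads) together with any body is a k-set. The pairs
(link, body) that span an edge of H form a bipartite graph on ν + ν vertices. A perfect matching π
of it inserts body π(i) between heads i and i+1, and the result is a type-ℓ Hamilton cycle
(`isHamiltonCycle_of_perm`). Edge-disjoint matchings give edge-disjoint cycles.

In a uniformly random ordering every link and every body is a uniformly random set. Hence P_a and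
P_b give degrees of at least about νp, and P_e and P_f give codegrees of at most about νp². A
transposition changes the relevant counts by a bounded amount, so they concentrate
(`sum_exp_perm_le`) and almost every ordering is regular (`card_not_isRegularOrder_le`).

One ordering sees only ν² of the k-sets. To use almost all edges, N independent regular orderings
are taken so that no k-set is a candidate in more than K of them, where K is barely above the
average Nν²/C(n,k) (`exists_regular_orders`). For each k-set, the orderings in which it is a
candidate receive distinct colours out of K. A random colour for each edge then hands it to at most
one ordering. This thins each of the N bipartite graphs by a factor K, leaving degrees of about νp/K
and codegrees of about νp²/K² (`exists_thinning`).

A bipartite graph with such degrees and codegrees contains (1 - 4ε)νp/K disjoint perfect matchings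
(`exists_disjoint_perms_of_codegree_le`): Cauchy–Schwarz bounds the number of edges between two
vertex sets, which verifies the Ore–Ryser condition for a regular spanning subgraph, and a regular
graph splits into matchings. The total over all N orderings is at least (1 - 8ε)m/ν. This suffices,
since 8ε ≤ 2ε^(1/3) for ε < 1/8 and the claim is trivial for larger ε. -/

namespace HypergraphPacking

/-! ### Concentration for functions of a random permutation. -/

/-- Hoeffding's lemma for the uniform distribution on a finite type. -/
theorem sum_exp_le_of_abs_sub_le {ι : Type*} [Fintype ι] (X : ι → ℝ) (m R : ℝ)
    (hR : ∀ i, |X i - m| ≤ R) (hm : ∑ i, X i = Fintype.card ι * m) :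
    ∑ i, Real.exp (X i) ≤ Fintype.card ι * Real.exp (m + R ^ 2 / 2) := by
  rcases eq_or_ne R 0 with rfl | hR0
  · have : ∀ i, X i = m := fun i => by
      have := abs_nonpos_iff.1 (hR i); linarith
    simp [this]
  -- By convexity `exp` lies below its chord on [-R, R]. The linear term of the chord sums to zero
  -- because `m` is the mean.
  have key : ∀ i, Real.exp (X i - m) ≤ Real.cosh R + (X i - m) / R * Real.sinh R := fun i => by
    have hRpos : 0 < R := lt_of_le_of_ne ((abs_nonneg _).trans (hR i)) (Ne.symm hR0)
    have h1 : |(X i - m) / R| ≤ 1 := by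
      rw [abs_div, abs_of_pos hRpos]; exact (div_le_one hRpos).2 (hR i)
    have h2 := Real.exp_mul_le_cosh_add_mul_sinh h1 R
    rwa [div_mul_cancel₀ _ hR0] at h2
  have h0 : ∑ i, (X i - m) = 0 := by
    rw [Finset.sum_sub_distrib, hm]; simp
  calc ∑ i, Real.exp (X i) = Real.exp m * ∑ i, Real.exp (X i - m) := by
        rw [Finset.mul_sum]
        exact Finset.sum_congr rfl fun i _ => by rw [← Real.exp_add]; ring_nf
    _ ≤ Real.exp m * ∑ i, (Real.cosh R + (X i - m) / R * Real.sinh R) := by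
        gcongr with i; exact key i
    _ = Real.exp m * (Fintype.card ι * Real.cosh R) := by
        rw [Finset.sum_add_distrib, ← Finset.sum_mul, ← Finset.sum_div, h0]; simp
    _ ≤ Real.exp m * (Fintype.card ι * Real.exp (R ^ 2 / 2)) := by
        gcongr; exact Real.cosh_le_exp_half_sq R
    _ = _ := by rw [Real.exp_add]; ring

open Equiv Equiv.Perm

/-- Once the image `p` of 0 is fixed, swapping two arguments of the remaining permutation is still a
swap, so a swap-Lipschitz function restricts to a swap-Lipschitz function with the same constant. -/
theorem decomposeFin_symm_mul_swap {n : ℕ} (p : Fin (n + 1)) (τ : Perm (Fin n)) (x y : Fin n) :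
    decomposeFin.symm (p, τ * swap x y) = decomposeFin.symm (p, τ) * swap x.succ y.succ := by
  ext1 z
  refine Fin.cases ?_ (fun z => ?_) z
  · rw [Perm.mul_apply, swap_apply_of_ne_of_ne (Fin.succ_ne_zero x).symm (Fin.succ_ne_zero y).symm]
    simp
  · have : swap x.succ y.succ z.succ = (swap x y z).succ := by
      simp only [swap_apply_def, Fin.succ_inj]; split_ifs <;> rfl
    rw [Perm.mul_apply, this]; simp

/-- Moving the image of 0 from 0 to `p` is left multiplication by a transposition, and conjugating
turns it into right multiplication by another. This pairs the fibres over `p` and over 0 by single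
swaps, so conditional means differ by at most the Lipschitz constant. -/
theorem decomposeFin_symm_eq_mul_swap {n : ℕ} (p : Fin (n + 1)) (τ : Perm (Fin n)) :
    ∃ x y, decomposeFin.symm (p, τ) = decomposeFin.symm (0, τ) * swap x y := by
  refine ⟨(decomposeFin.symm (0, τ))⁻¹ 0, (decomposeFin.symm (0, τ))⁻¹ p, ?_⟩
  rw [← swap_mul_eq_mul_swap]
  ext1 z
  refine Fin.cases ?_ (fun z => ?_) z <;> simp

/-- Exponential moments of functions of a random permutation that are Lipschitz with respect to
transpositions. -/
theorem sum_exp_perm_le {n : ℕ} (f : Perm (Fin n) → ℝ) (c : ℝ)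
    (hf : ∀ σ x y, |f (σ * swap x y) - f σ| ≤ c) :
    ∑ σ, Real.exp (f σ) ≤
      (n.factorial : ℝ) * Real.exp ((∑ σ, f σ) / n.factorial + 2 * c ^ 2 * n) := by
  induction n with
  | zero => simp
  | succ n ih =>
    -- `g p` is the conditional mean of `f` given that 0 is sent to `p`.
    set g : Fin (n + 1) → ℝ := fun p => (∑ τ, f (decomposeFin.symm (p, τ))) / n.factorial with hg
    have hn0 : (0 : ℝ) < n.factorial := by exact_mod_cast n.factorial_pos
    have hsum : ∀ F : Perm (Fin (n + 1)) → ℝ, ∑ σ, F σ = ∑ p, ∑ τ, F (decomposeFin.symm (p, τ)) :=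
      fun F => by rw [← Fintype.sum_prod_type', ← Equiv.sum_comp decomposeFin.symm]
    have h1 : ∀ p, ∑ τ, Real.exp (f (decomposeFin.symm (p, τ))) ≤
        (n.factorial : ℝ) * Real.exp (g p + 2 * c ^ 2 * n) := fun p =>
      ih (fun τ => f (decomposeFin.symm (p, τ)))
        (fun τ x y => by simpa only [decomposeFin_symm_mul_swap] using hf _ _ _)
    have hg0 : ∀ p, |g p - g 0| ≤ c := fun p => by
      rw [hg, ← sub_div, ← Finset.sum_sub_distrib, abs_div, abs_of_pos hn0, div_le_iff₀ hn0]
      refine (Finset.abs_sum_le_sum_abs _ _).trans ?_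
      refine (Finset.sum_le_card_nsmul _ _ c fun τ _ => ?_).trans ?_
      · obtain ⟨x, y, h⟩ := decomposeFin_symm_eq_mul_swap p τ
        rw [h]; exact hf _ _ _
      · simp [Fintype.card_perm, mul_comm]
    set m : ℝ := (∑ p, g p) / (n + 1) with hm
    have hn1 : (0 : ℝ) < n + 1 := by positivity
    have hm0 : |m - g 0| ≤ c := by
      have : m - g 0 = (∑ p, (g p - g 0)) / (n + 1) := by
        rw [Finset.sum_sub_distrib, hm]; simp; field_simp
      rw [this, abs_div, abs_of_pos hn1, div_le_iff₀ hn1]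
      refine (Finset.abs_sum_le_sum_abs _ _).trans ?_
      refine (Finset.sum_le_card_nsmul _ _ c fun p _ => hg0 p).trans ?_
      simp [mul_comm]
    -- Each `g p` and the mean `m` are within `c` of `g 0`, so the radius is 2c. Hoeffding's lemma
    -- then costs (2c)²/2 = 2c² per revealed image.
    have h2 := sum_exp_le_of_abs_sub_le g m (2 * c)
      (fun p => by
        have := abs_le.1 (hg0 p); have := abs_le.1 hm0
        exact abs_le.2 ⟨by linarith, by linarith⟩)
      (by rw [hm]; simp; field_simp)
    have hm' : (∑ σ, f σ) / (n + 1).factorial = m := by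
      rw [hsum, hm, hg, ← Finset.sum_div, Nat.factorial_succ]; push_cast; field_simp
    rw [hm', hsum]
    calc _ ≤ ∑ p, (n.factorial : ℝ) * Real.exp (g p + 2 * c ^ 2 * n) :=
          Finset.sum_le_sum fun p _ => h1 p
      _ = (n.factorial : ℝ) * Real.exp (2 * c ^ 2 * n) * ∑ p, Real.exp (g p) := by
          rw [Finset.mul_sum]
          exact Finset.sum_congr rfl fun p _ => by rw [Real.exp_add]; ring
      _ ≤ (n.factorial : ℝ) * Real.exp (2 * c ^ 2 * n) *
            (Fintype.card (Fin (n + 1)) * Real.exp (m + (2 * c) ^ 2 / 2)) := by gcongr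
      _ = _ := by
          rw [Nat.factorial_succ, Fintype.card_fin]
          have : m + 2 * c ^ 2 * ((n + 1 : ℕ) : ℝ) =
            2 * c ^ 2 * n + (m + (2 * c) ^ 2 / 2) := by push_cast; ring
          rw [this, Real.exp_add (2 * c ^ 2 * n)]; push_cast; ring

theorem exists_perm_image_eq {n : ℕ} {S T : Finset (Fin n)} (h : S.card = T.card) :
    ∃ τ : Perm (Fin n), S.image τ = T := by
  refine ⟨(Finset.equivOfCardEq h).extendSubtype, ?_⟩
  refine Finset.eq_of_subset_of_card_le (fun x hx => ?_) ?_
  · obtain ⟨y, hy, rfl⟩ := Finset.mem_image.1 hx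
    exact Equiv.extendSubtype_mem (p := fun z => z ∈ S) (q := fun z => z ∈ T)
      (Finset.equivOfCardEq h) y hy
  · rw [Finset.card_image_of_injective _ (Equiv.injective _), h]

/-- The image of a fixed set under a random permutation is uniform: left multiplication by a
permutation carrying one target to another is a bijection between the fibres. -/
theorem card_perm_image_eq {n : ℕ} (D S : Finset (Fin n)) (h : S.card = D.card) :
    (Finset.univ.filter (fun σ : Perm (Fin n) => D.image σ = S)).card * n.choose D.card =
      n.factorial := by
  have h1 : ∀ T ∈ Finset.powersetCard D.card (Finset.univ : Finset (Fin n)),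
      (Finset.univ.filter (fun σ : Perm (Fin n) => D.image σ = T)).card =
      (Finset.univ.filter (fun σ : Perm (Fin n) => D.image σ = S)).card := fun T hT => by
    obtain ⟨τ, rfl⟩ := exists_perm_image_eq (S := S) (T := T)
      (h.trans (Finset.mem_powersetCard.1 hT).2.symm)
    symm
    refine Finset.card_bij' (fun σ _ => τ * σ) (fun σ _ => τ⁻¹ * σ) ?_ ?_ ?_ ?_
    · intro σ hσ
      simp only [Finset.mem_filter, Finset.mem_univ, true_and] at hσ ⊢
      rw [← hσ, Finset.image_image]; rfl
    · intro σ hσ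
      simp only [Finset.mem_filter, Finset.mem_univ, true_and] at hσ ⊢
      have : D.image (τ⁻¹ * σ : Perm (Fin n)) = (D.image σ).image (τ⁻¹ : Perm (Fin n)) := by
        rw [Finset.image_image]; rfl
      rw [this, hσ, Finset.image_image]
      have : ((τ⁻¹ : Perm (Fin n)) : Fin n → Fin n) ∘ τ = id := by ext; simp
      rw [this, Finset.image_id]
    · intro σ _; simp
    · intro σ _; simp
  have h2 := Finset.card_eq_sum_card_fiberwise (s := (Finset.univ : Finset (Perm (Fin n))))
    (t := Finset.powersetCard D.card (Finset.univ : Finset (Fin n)))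
    (f := fun σ : Perm (Fin n) => D.image σ) (fun σ _ => by
      simp [Finset.mem_powersetCard, Finset.card_image_of_injective _ σ.injective])
  rw [Finset.sum_congr rfl h1, Finset.sum_const, Finset.card_powersetCard, Finset.card_univ,
    Finset.card_univ, Fintype.card_perm, Fintype.card_fin, smul_eq_mul] at h2
  rw [h2, mul_comm]

/-- The number of blocks whose image under the permutation lies in the family `F`. -/
def blockCount {n ν : ℕ} (D : Fin ν → Finset (Fin n)) (F : Finset (Finset (Fin n)))
    (σ : Perm (Fin n)) : ℕ :=
  (Finset.univ.filter (fun j => (D j).image σ ∈ F)).card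

theorem sum_blockCount {n ν c : ℕ} (hc : c ≤ n) (D : Fin ν → Finset (Fin n))
    (hD : ∀ j, (D j).card = c)
    (F : Finset (Finset (Fin n))) (hF : ∀ S ∈ F, S.card = c) :
    (∑ σ, (blockCount D F σ : ℝ)) / n.factorial = ν * F.card / n.choose c := by
  have hpos : (0 : ℝ) < n.choose c := by exact_mod_cast Nat.choose_pos hc
  have hn0 : (0 : ℝ) < n.factorial := by exact_mod_cast n.factorial_pos
  have h1 : ∀ j, ∀ S ∈ F, ((Finset.univ.filter
      (fun σ : Perm (Fin n) => (D j).image σ = S)).card : ℝ) = n.factorial / n.choose c := by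
    intro j S hS
    rw [eq_div_iff hpos.ne']
    have := card_perm_image_eq (D j) S ((hF S hS).trans (hD j).symm)
    rw [hD j] at this
    exact_mod_cast this
  have h2 : ∑ σ, (blockCount D F σ : ℝ) = ∑ j : Fin ν, ∑ S ∈ F, ((Finset.univ.filter
      (fun σ : Perm (Fin n) => (D j).image σ = S)).card : ℝ) := by
    simp only [blockCount, Finset.card_filter, Nat.cast_sum]
    rw [Finset.sum_comm]
    refine Finset.sum_congr rfl fun j _ => ?_
    rw [Finset.sum_comm]
    refine Finset.sum_congr rfl fun σ _ => ?_
    simp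
  rw [h2, Finset.sum_congr rfl fun j _ => Finset.sum_congr rfl fun S hS => h1 j S hS]
  simp only [Finset.sum_const, Finset.card_univ, Fintype.card_fin, nsmul_eq_mul]
  field_simp

/-- A swap of `x` and `y` affects only blocks containing `x` or `y`, and there are at most two of
each kind. -/
theorem blockCount_mul_swap_le {n ν : ℕ} (D : Fin ν → Finset (Fin n))
    (hD : ∀ x, (Finset.univ.filter (fun j => x ∈ D j)).card ≤ 2)
    (F : Finset (Finset (Fin n))) (σ : Perm (Fin n)) (x y : Fin n) :
    blockCount D F (σ * swap x y) ≤ blockCount D F σ + 4 := by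
  have h : Finset.univ.filter (fun j => (D j).image (σ * swap x y : Perm (Fin n)) ∈ F) ⊆
      Finset.univ.filter (fun j => (D j).image σ ∈ F) ∪
      (Finset.univ.filter (fun j => x ∈ D j) ∪ Finset.univ.filter (fun j => y ∈ D j)) := by
    intro j hj
    simp only [Finset.mem_union, Finset.mem_filter, Finset.mem_univ, true_and] at hj ⊢
    by_cases hx : x ∈ D j
    · exact Or.inr (Or.inl hx)
    by_cases hy : y ∈ D j
    · exact Or.inr (Or.inr hy)
    left
    have : (D j).image (σ * swap x y : Perm (Fin n)) = (D j).image σ := by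
      refine Finset.image_congr fun z hz => ?_
      rw [Perm.mul_apply, swap_apply_of_ne_of_ne]
      · rintro rfl; exact hx hz
      · rintro rfl; exact hy hz
    rwa [← this]
  have h1 := Finset.card_le_card h
  have h2 := Finset.card_union_le (Finset.univ.filter (fun j => (D j).image σ ∈ F))
    (Finset.univ.filter (fun j => x ∈ D j) ∪ Finset.univ.filter (fun j => y ∈ D j))
  have h3 := Finset.card_union_le (Finset.univ.filter (fun j => x ∈ D j))
    (Finset.univ.filter (fun j => y ∈ D j))
  have := hD x
  have := hD y
  unfold blockCount
  omega

theorem abs_blockCount_mul_swap_sub_le {n ν : ℕ} (D : Fin ν → Finset (Fin n))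
    (hD : ∀ x, (Finset.univ.filter (fun j => x ∈ D j)).card ≤ 2)
    (F : Finset (Finset (Fin n))) (σ : Perm (Fin n)) (x y : Fin n) :
    |(blockCount D F (σ * swap x y) : ℝ) - blockCount D F σ| ≤ 4 := by
  have h1 := blockCount_mul_swap_le D hD F σ x y
  have h2 := blockCount_mul_swap_le D hD F (σ * swap x y) x y
  rw [mul_assoc, swap_mul_self, mul_one] at h2
  have h1' : (blockCount D F (σ * swap x y) : ℝ) ≤ blockCount D F σ + 4 := by exact_mod_cast h1
  have h2' : (blockCount D F σ : ℝ) ≤ blockCount D F (σ * swap x y) + 4 := by exact_mod_cast h2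
  exact abs_le.2 ⟨by linarith, by linarith⟩

/-- Chernoff's bound for the upper tail of a swap-Lipschitz function of a random permutation. -/
theorem card_perm_tail_le {n : ℕ} (hn : 0 < n) (f : Perm (Fin n) → ℝ)
    (hf : ∀ σ x y, |f (σ * swap x y) - f σ| ≤ 4) (s t : ℝ) (ht : 0 ≤ t)
    (hs : (∑ σ, f σ) / n.factorial + t ≤ s) :
    ((Finset.univ.filter (fun σ => s ≤ f σ)).card : ℝ) ≤
      n.factorial * Real.exp (-(t ^ 2 / (128 * n))) := by
  have hn' : (0 : ℝ) < n := by exact_mod_cast hn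
  -- The minimiser of 2(4l)²n - lt, whose minimum is -t²/(128n).
  set l : ℝ := t / (64 * n) with hl
  have hl0 : 0 ≤ l := by positivity
  have h := sum_exp_perm_le (fun σ => l * f σ) (4 * l) (fun σ x y => by
    rw [← mul_sub, abs_mul, abs_of_nonneg hl0]
    nlinarith [hf σ x y])
  rw [← Finset.mul_sum] at h
  have h1 : ((Finset.univ.filter (fun σ => s ≤ f σ)).card : ℝ) * Real.exp (l * s) ≤
      ∑ σ, Real.exp (l * f σ) := by
    rw [← nsmul_eq_mul]
    refine (Finset.card_nsmul_le_sum _ (fun σ => Real.exp (l * f σ)) _ fun σ hσ => ?_).trans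
      (Finset.sum_le_sum_of_subset_of_nonneg (Finset.subset_univ _)
        fun _ _ _ => (Real.exp_pos _).le)
    have := (Finset.mem_filter.1 hσ).2
    exact Real.exp_le_exp.2 (mul_le_mul_of_nonneg_left this hl0)
  have h2 := h1.trans h
  rw [← le_div_iff₀ (Real.exp_pos _), mul_div_assoc, ← Real.exp_sub] at h2
  refine h2.trans ?_
  gcongr
  have e1 : l * (∑ σ, f σ) / n.factorial = l * ((∑ σ, f σ) / n.factorial) := by ring
  rw [e1]
  have e2 : 2 * (4 * l) ^ 2 * n - l * t = -(t ^ 2 / (128 * n)) := by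
    rw [hl]; field_simp; ring
  rw [← e2]
  nlinarith

theorem card_blockCount_ge_le {n ν c : ℕ} (hn : 0 < n) (hc : c ≤ n) (D : Fin ν → Finset (Fin n))
    (hDc : ∀ j, (D j).card = c)
    (hD : ∀ x, (Finset.univ.filter (fun j => x ∈ D j)).card ≤ 2)
    (F : Finset (Finset (Fin n))) (hF : ∀ S ∈ F, S.card = c) (s t : ℝ) (ht : 0 ≤ t)
    (hs : ν * F.card / n.choose c + t ≤ s) :
    ((Finset.univ.filter (fun σ => s < blockCount D F σ)).card : ℝ) ≤
      n.factorial * Real.exp (-(t ^ 2 / (128 * n))) := by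
  refine le_trans ?_ (card_perm_tail_le hn (fun σ => (blockCount D F σ : ℝ))
    (abs_blockCount_mul_swap_sub_le D hD F) s t ht (by rwa [sum_blockCount hc D hDc F hF]))
  exact_mod_cast Finset.card_le_card fun σ hσ => by
    simp only [Finset.mem_filter, Finset.mem_univ, true_and] at hσ ⊢; exact hσ.le

theorem card_blockCount_le_le {n ν c : ℕ} (hn : 0 < n) (hc : c ≤ n) (D : Fin ν → Finset (Fin n))
    (hDc : ∀ j, (D j).card = c)
    (hD : ∀ x, (Finset.univ.filter (fun j => x ∈ D j)).card ≤ 2)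
    (F : Finset (Finset (Fin n))) (hF : ∀ S ∈ F, S.card = c) (s t : ℝ) (ht : 0 ≤ t)
    (hs : s + t ≤ ν * F.card / n.choose c) :
    ((Finset.univ.filter (fun σ => (blockCount D F σ : ℝ) < s)).card : ℝ) ≤
      n.factorial * Real.exp (-(t ^ 2 / (128 * n))) := by
  have key := card_perm_tail_le hn (fun σ => -(blockCount D F σ : ℝ))
    (fun σ x y => by
      rw [neg_sub_neg, abs_sub_comm]; exact abs_blockCount_mul_swap_sub_le D hD F σ x y) (-s) t ht
      (by rw [Finset.sum_neg_distrib, neg_div, sum_blockCount hc D hDc F hF]; linarith)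
  refine le_trans (Nat.cast_le.2 (Finset.card_le_card fun σ hσ => ?_)) key
  simp only [Finset.mem_filter, Finset.mem_univ, true_and] at hσ ⊢
  exact neg_le_neg hσ.le

/-! ### Regular spanning subgraphs and perfect matchings of bipartite graphs. -/

theorem sum_card_fiber_eq {β γ : Type*} [DecidableEq γ] (G : Finset β) (f : β → γ)
    (S : Finset γ) :
    ∑ x ∈ S, (G.filter (fun p => f p = x)).card = (G.filter (fun p => f p ∈ S)).card := by
  have h : ∀ p ∈ G.filter (fun p => f p ∈ S), f p ∈ S := fun p hp => (Finset.mem_filter.1 hp).2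
  refine ((Finset.card_eq_sum_card_fiberwise h).trans ?_).symm
  refine Finset.sum_congr rfl fun x hx => ?_
  rw [Finset.filter_filter]
  exact congrArg _ (Finset.filter_congr fun p _ => ⟨fun e => e.2, fun e => ⟨e ▸ hx, e⟩⟩)

/-- A bipartite graph satisfying the Ore–Ryser condition has an `r`-regular spanning subgraph. -/
theorem exists_regular_subgraph {α : Type*} [Fintype α] [DecidableEq α] (G : Finset (α × α))
    (r : ℕ)
    (h : ∀ S T : Finset α,
      r * S.card ≤ r * T.card + (G.filter (fun p => p.1 ∈ S ∧ p.2 ∉ T)).card)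
    (h' : ∀ y, r ≤ (G.filter (fun p => p.2 = y)).card) :
    ∃ G' ⊆ G, (∀ x, (G'.filter (fun p => p.1 = x)).card = r) ∧
      ∀ y, (G'.filter (fun p => p.2 = y)).card = r := by
  classical
  set dX : α → ℕ := fun x => (G.filter (fun p => p.1 = x)).card with hdX
  set dY : α → ℕ := fun y => (G.filter (fun p => p.2 = y)).card with hdY
  have hX : ∀ x, r ≤ dX x := fun x => by
    have := h {x} ∅
    simpa [hdX] using this
  have hsumX : ∀ S : Finset α, ∑ x ∈ S, dX x = (G.filter (fun p => p.1 ∈ S)).card :=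
    sum_card_fiber_eq G Prod.fst
  have hsumY : ∀ T : Finset α, ∑ y ∈ T, dY y = (G.filter (fun p => p.2 ∈ T)).card :=
    sum_card_fiber_eq G Prod.snd
  let CX := Σ x : α, Fin (dX x - r)
  let CY := Σ y : α, Fin (dY y - r)
  -- An auxiliary matching problem: a left copy of an edge is matched to its own right copy (the
  -- edge is kept) or to one of the dX x - r dummies at its first endpoint (the edge is deleted).
  -- Each of the dY y - r dummies at `y` occupies the right copy of some edge at `y`. A perfect
  -- matching therefore leaves exactly `r` kept edges at every vertex on both sides.
  let t : G ⊕ CY → Finset (G ⊕ CX) := Sum.elim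
    (fun e => Finset.univ.filter (fun z => z = Sum.inl e ∨ ∃ i, z = Sum.inr ⟨e.1.1, i⟩))
    (fun c => Finset.univ.filter (fun z => ∃ e : G, e.1.2 = c.1 ∧ z = Sum.inl e))
  have hall : ∀ W : Finset (G ⊕ CY), W.card ≤ (W.biUnion t).card := by
    intro W
    set P : Finset (α × α) := G.filter (fun p => ∃ hp : p ∈ G, Sum.inl ⟨p, hp⟩ ∈ W) with hP
    set T : Finset α := Finset.univ.filter (fun y => ∃ i, Sum.inr ⟨y, i⟩ ∈ W) with hT
    set S : Finset α := P.image Prod.fst with hS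
    have hPG : P ⊆ G := Finset.filter_subset _ _
    have hW : W.card ≤ P.card + ∑ y ∈ T, (dY y - r) := by
      rw [← Finset.card_toLeft_add_card_toRight]
      refine add_le_add ?_ ?_
      · refine Finset.card_le_card_of_injOn (fun e => e.1) (fun e he => ?_)
          (fun e _ e' _ hee => Subtype.ext hee)
        have := Finset.mem_toLeft.1 he
        exact Finset.mem_filter.2 ⟨e.2, e.2, this⟩
      · have : W.toRight ⊆ T.sigma (fun _ => Finset.univ) := fun c hc => by
          rw [Finset.mem_sigma]
          exact ⟨Finset.mem_filter.2 ⟨Finset.mem_univ _, c.2, Finset.mem_toRight.1 hc⟩,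
            Finset.mem_univ _⟩
        refine (Finset.card_le_card this).trans ((Finset.card_sigma _ _).trans_le ?_)
        simp
    have hN : (P ∪ G.filter (fun p => p.2 ∈ T)).card + ∑ x ∈ S, (dX x - r) ≤
        (W.biUnion t).card := by
      rw [← Finset.card_toLeft_add_card_toRight]
      refine add_le_add ?_ ?_
      · have : P ∪ G.filter (fun p => p.2 ∈ T) ⊆ (W.biUnion t).toLeft.map
            (Function.Embedding.subtype _) := by
          intro p hp
          rw [Finset.mem_union] at hp
          rcases hp with hp | hp
          · obtain ⟨h1, h2, h3⟩ := Finset.mem_filter.1 hp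
            refine Finset.mem_map.2 ⟨⟨p, h1⟩, Finset.mem_toLeft.2 ?_, rfl⟩
            exact Finset.mem_biUnion.2 ⟨_, h3, by simp [t]⟩
          · obtain ⟨h1, h2⟩ := Finset.mem_filter.1 hp
            obtain ⟨i, hi⟩ := (Finset.mem_filter.1 h2).2
            refine Finset.mem_map.2 ⟨⟨p, h1⟩, Finset.mem_toLeft.2 ?_, rfl⟩
            exact Finset.mem_biUnion.2 ⟨_, hi, Finset.mem_filter.2 ⟨Finset.mem_univ _, ⟨p, h1⟩, rfl, rfl⟩⟩
        refine (Finset.card_le_card this).trans ?_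
        rw [Finset.card_map]
      · have : S.sigma (fun _ => Finset.univ) ⊆ (W.biUnion t).toRight := by
          intro c hc
          obtain ⟨h1, -⟩ := Finset.mem_sigma.1 hc
          obtain ⟨p, hp, hpc⟩ := Finset.mem_image.1 h1
          obtain ⟨h1, h2, h3⟩ := Finset.mem_filter.1 hp
          refine Finset.mem_toRight.2 (Finset.mem_biUnion.2 ⟨_, h3, ?_⟩)
          obtain ⟨x, i⟩ := c
          obtain rfl : p.1 = x := hpc
          simp [t]
        refine le_trans (le_of_eq ?_) (Finset.card_le_card this)
        refine Eq.trans ?_ (Finset.card_sigma _ _).symm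
        simp
    -- Cancelling the degree sums reduces Hall's condition to the hypothesis `h S T`, because the
    -- edges of `P` that end in `T` and the edges from `S` avoiding `T` are disjoint sets of edges
    -- leaving `S`.
    refine hW.trans (le_trans ?_ hN)
    have e1 : ∑ y ∈ T, (dY y - r) + r * T.card = (G.filter (fun p => p.2 ∈ T)).card := by
      rw [← hsumY, mul_comm, ← smul_eq_mul, ← Finset.sum_const, ← Finset.sum_add_distrib]
      exact Finset.sum_congr rfl fun y _ => Nat.sub_add_cancel (h' y)
    have e2 : ∑ x ∈ S, (dX x - r) + r * S.card = (G.filter (fun p => p.1 ∈ S)).card := by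
      rw [← hsumX, mul_comm, ← smul_eq_mul, ← Finset.sum_const, ← Finset.sum_add_distrib]
      exact Finset.sum_congr rfl fun y _ => Nat.sub_add_cancel (hX y)
    have e3 := Finset.card_union_add_card_inter P (G.filter (fun p => p.2 ∈ T))
    have e4 : (P ∩ G.filter (fun p => p.2 ∈ T)).card +
        (G.filter (fun p => p.1 ∈ S ∧ p.2 ∉ T)).card ≤ (G.filter (fun p => p.1 ∈ S)).card := by
      rw [← Finset.card_union_of_disjoint]
      · refine Finset.card_le_card fun p hp => ?_
        rw [Finset.mem_union] at hp
        rcases hp with hp | hp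
        · have hp1 := (Finset.mem_inter.1 hp).1
          exact Finset.mem_filter.2 ⟨hPG hp1, Finset.mem_image_of_mem _ hp1⟩
        · have hp1 := Finset.mem_filter.1 hp
          exact Finset.mem_filter.2 ⟨hp1.1, hp1.2.1⟩
      · refine Finset.disjoint_left.2 fun p hp hp' => ?_
        exact (Finset.mem_filter.1 hp').2.2 (Finset.mem_filter.1 (Finset.mem_inter.1 hp).2).2
    have e5 := h S T
    omega
  obtain ⟨f, hf, hft⟩ := (Finset.all_card_le_biUnion_card_iff_exists_injective t).1 hall
  have hfinl : ∀ e : G, f (Sum.inl e) = Sum.inl e ∨ ∃ i, f (Sum.inl e) = Sum.inr ⟨e.1.1, i⟩ :=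
    fun e => by simpa [t] using hft (Sum.inl e)
  have hfinr : ∀ c : CY, ∃ e : G, e.1.2 = c.1 ∧ f (Sum.inr c) = Sum.inl e :=
    fun c => (Finset.mem_filter.1 (hft (Sum.inr c))).2
  -- Both sides have |G| dummies less r|α|, so the injection supplied by Hall's theorem is also
  -- onto.
  have hcard : Fintype.card (G ⊕ CY) = Fintype.card (G ⊕ CX) := by
    have e1 : ∑ y, (dY y - r) + r * Fintype.card α = G.card := by
      have : G.card = ∑ y, dY y := by rw [hsumY]; simp
      rw [this, mul_comm, ← smul_eq_mul, ← Finset.card_univ, ← Finset.sum_const,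
        ← Finset.sum_add_distrib]
      exact Finset.sum_congr rfl fun y _ => Nat.sub_add_cancel (h' y)
    have e2 : ∑ x, (dX x - r) + r * Fintype.card α = G.card := by
      have : G.card = ∑ y, dX y := by rw [hsumX]; simp
      rw [this, mul_comm, ← smul_eq_mul, ← Finset.card_univ, ← Finset.sum_const,
        ← Finset.sum_add_distrib]
      exact Finset.sum_congr rfl fun y _ => Nat.sub_add_cancel (hX y)
    simp only [Fintype.card_sum, CX, CY, Fintype.card_sigma, Fintype.card_fin]
    omega
  have hbij : Function.Bijective f := (Fintype.bijective_iff_injective_and_card f).2 ⟨hf, hcard⟩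
  have hattach : ∀ (q : α × α → Prop) [DecidablePred q], (G.filter q).card =
      (Finset.univ.filter (fun e : G => q e.1)).card := fun q _ => by
    rw [← Finset.card_map (Function.Embedding.subtype _)]
    congr 1
    ext p
    simp only [Finset.mem_filter, Finset.mem_map, Finset.mem_univ, true_and]
    exact ⟨fun h => ⟨⟨p, h.1⟩, h.2, rfl⟩, by rintro ⟨e, h, rfl⟩; exact ⟨e.2, h⟩⟩
  refine ⟨G.filter (fun p => ∃ hp : p ∈ G, f (Sum.inl ⟨p, hp⟩) = Sum.inl ⟨p, hp⟩),
    Finset.filter_subset _ _, fun x => ?_, fun y => ?_⟩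
  · rw [Finset.filter_filter, hattach]
    have h1 : (Finset.univ.filter (fun e : G => e.1.1 = x)).card =
        (Finset.univ.filter (fun e : G => (∃ hp : e.1 ∈ G, f (Sum.inl ⟨e.1, hp⟩) =
          Sum.inl ⟨e.1, hp⟩) ∧ e.1.1 = x)).card +
        (Finset.univ.filter (fun e : G => f (Sum.inl e) ≠ Sum.inl e ∧ e.1.1 = x)).card := by
      rw [← Finset.card_union_of_disjoint]
      · congr 1
        ext e
        simp only [Finset.mem_filter, Finset.mem_univ, true_and, Finset.mem_union]
        have : (∃ hp : e.1 ∈ G, f (Sum.inl ⟨e.1, hp⟩) = Sum.inl ⟨e.1, hp⟩) ↔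
          f (Sum.inl e) = Sum.inl e := ⟨fun ⟨_, h⟩ => h, fun h => ⟨e.2, h⟩⟩
        tauto
      · refine Finset.disjoint_left.2 fun e h1 h2 => ?_
        obtain ⟨⟨_, h3⟩, _⟩ := (Finset.mem_filter.1 h1).2
        exact (Finset.mem_filter.1 h2).2.1 h3
    -- Surjectivity onto the dummies at `x`, which only edges at `x` can reach, counts the deleted
    -- edges there.
    have h2 : (Finset.univ.filter
        (fun e : G => f (Sum.inl e) ≠ Sum.inl e ∧ e.1.1 = x)).card = dX x - r := by
      rw [← Finset.card_image_of_injective _ (hf.comp Sum.inl_injective)]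
      have : (Finset.univ : Finset (Fin (dX x - r))).image
          (fun i => (Sum.inr ⟨x, i⟩ : G ⊕ CX)) = Finset.image (f ∘ Sum.inl) (Finset.univ.filter
          (fun e : G => f (Sum.inl e) ≠ Sum.inl e ∧ e.1.1 = x)) := by
        ext z
        simp only [Finset.mem_image, Finset.mem_univ, true_and, Finset.mem_filter,
          Function.comp_apply]
        constructor
        · rintro ⟨i, rfl⟩
          obtain ⟨u, hu⟩ := hbij.2 (Sum.inr ⟨x, i⟩)
          rcases u with e | c
          · refine ⟨e, ⟨by rw [hu]; simp, ?_⟩, hu⟩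
            rcases hfinl e with h | ⟨j, h⟩
            · rw [h] at hu; cases hu
            · rw [h] at hu; cases hu; rfl
          · obtain ⟨e, _, h⟩ := hfinr c
            rw [h] at hu; cases hu
        · rintro ⟨e, ⟨hne, rfl⟩, rfl⟩
          rcases hfinl e with h | ⟨j, h⟩
          · exact absurd h hne
          · exact ⟨j, h.symm⟩
      rw [← this, Finset.card_image_of_injective]
      · simp
      · intro i j hij; exact eq_of_heq (Sigma.mk.inj (Sum.inr_injective hij)).2
    have h3 : dX x = (Finset.univ.filter (fun e : G => e.1.1 = x)).card := hattach _
    have := hX x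
    omega
  · rw [Finset.filter_filter, hattach]
    -- The right copies of edges at `y` are all occupied, either by their own left copies or by
    -- dummies; every dummy at `y` is used among them, which leaves `r` kept edges.
    have h1 : (Finset.univ.filter (fun z : G ⊕ CY => ∃ e : G, e.1.2 = y ∧ f z = Sum.inl e)).card =
        dY y := by
      have h0 : dY y = (Finset.univ.filter (fun e : G => e.1.2 = y)).card := hattach _
      rw [← Finset.card_image_of_injective _ hf, h0,
        ← Finset.card_image_of_injective (β := G ⊕ CX) _ Sum.inl_injective]
      congr 1
      ext z
      simp only [Finset.mem_image, Finset.mem_univ, true_and, Finset.mem_filter]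
      constructor
      · rintro ⟨u, ⟨e, he, hu⟩, rfl⟩
        exact ⟨e, he, hu.symm⟩
      · rintro ⟨e, he, rfl⟩
        obtain ⟨u, hu⟩ := hbij.2 (Sum.inl e)
        exact ⟨u, ⟨e, he, hu⟩, hu⟩
    rw [← Finset.card_toLeft_add_card_toRight] at h1
    have h2 : (Finset.univ.filter
        (fun z : G ⊕ CY => ∃ e : G, e.1.2 = y ∧ f z = Sum.inl e)).toRight.card = dY y - r := by
      have : (Finset.univ.filter
        (fun z : G ⊕ CY => ∃ e : G, e.1.2 = y ∧ f z = Sum.inl e)).toRight =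
        (Finset.univ : Finset (Fin (dY y - r))).image (fun i => (⟨y, i⟩ : CY)) := by
        ext c
        simp only [Finset.mem_toRight, Finset.mem_filter, Finset.mem_univ, true_and,
          Finset.mem_image]
        obtain ⟨e, he, hc⟩ := hfinr c
        constructor
        · rintro ⟨e', rfl, h⟩
          rw [hc] at h
          obtain rfl := Sum.inl_injective h
          obtain ⟨c1, c2⟩ := c
          obtain rfl : e.1.2 = c1 := he
          exact ⟨c2, rfl⟩
        · rintro ⟨i, rfl⟩
          exact ⟨e, he, hc⟩
      rw [this, Finset.card_image_of_injective]
      · simp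
      · intro i j hij; exact eq_of_heq (Sigma.mk.inj hij).2
    have h3 : (Finset.univ.filter
        (fun z : G ⊕ CY => ∃ e : G, e.1.2 = y ∧ f z = Sum.inl e)).toLeft =
        Finset.univ.filter (fun e : G => (∃ hp : e.1 ∈ G, f (Sum.inl ⟨e.1, hp⟩) =
          Sum.inl ⟨e.1, hp⟩) ∧ e.1.2 = y) := by
      ext e
      simp only [Finset.mem_toLeft, Finset.mem_filter, Finset.mem_univ, true_and]
      constructor
      · rintro ⟨e', h1, h2⟩
        rcases hfinl e with h | ⟨j, h⟩
        · rw [h] at h2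
          obtain rfl := Sum.inl_injective h2
          exact ⟨⟨e.2, h⟩, h1⟩
        · rw [h] at h2; cases h2
      · rintro ⟨⟨_, h1⟩, h2⟩
        exact ⟨e, h2, h1⟩
    rw [h3] at h1
    have := h' y
    change r ≤ dY y at this
    omega

/-- A regular bipartite graph decomposes into perfect matchings. -/
theorem exists_perms_of_regular {α : Type*} [Fintype α] [DecidableEq α] (r : ℕ)
    (G : Finset (α × α)) (hX : ∀ x, (G.filter (fun p => p.1 = x)).card = r)
    (hY : ∀ y, (G.filter (fun p => p.2 = y)).card = r) :
    ∃ π : Fin r → Equiv.Perm α, (∀ s x, (x, π s x) ∈ G) ∧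
      ∀ s s', s ≠ s' → ∀ x, π s x ≠ π s' x := by
  induction r generalizing G with
  | zero => exact ⟨fun s => s.elim0, fun s => s.elim0, fun s => s.elim0⟩
  | succ r ih =>
    -- Hall's condition by double counting: all (r+1)|S| edges leaving `S` enter its neighbourhood,
    -- each vertex of which receives r+1.
    have hall : ∀ S : Finset α, S.card ≤
        (S.biUnion fun x => (G.filter (fun p => p.1 = x)).image Prod.snd).card := by
      intro S
      set T := S.biUnion fun x => (G.filter (fun p => p.1 = x)).image Prod.snd with hT
      have h1 : (G.filter (fun p => p.1 ∈ S)).card = S.card * (r + 1) := by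
        rw [← smul_eq_mul, ← Finset.sum_const, ← sum_card_fiber_eq G Prod.fst]
        exact Finset.sum_congr rfl fun x _ => hX x
      have h2 : (G.filter (fun p => p.2 ∈ T)).card = T.card * (r + 1) := by
        rw [← smul_eq_mul, ← Finset.sum_const, ← sum_card_fiber_eq G Prod.snd]
        exact Finset.sum_congr rfl fun x _ => hY x
      have h3 : (G.filter (fun p => p.1 ∈ S)).card ≤ (G.filter (fun p => p.2 ∈ T)).card := by
        refine Finset.card_le_card fun p hp => ?_
        obtain ⟨h1, h2⟩ := Finset.mem_filter.1 hp
        refine Finset.mem_filter.2 ⟨h1, Finset.mem_biUnion.2 ⟨p.1, h2, ?_⟩⟩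
        exact Finset.mem_image_of_mem _ (Finset.mem_filter.2 ⟨h1, rfl⟩)
      rw [h1, h2] at h3
      exact Nat.le_of_mul_le_mul_right h3 r.succ_pos
    obtain ⟨f, hf, hft⟩ := (Finset.all_card_le_biUnion_card_iff_exists_injective _).1 hall
    set φ : Equiv.Perm α := Equiv.ofBijective f (Finite.injective_iff_bijective.1 hf) with hφ
    have hφG : ∀ x, (x, φ x) ∈ G := fun x => by
      obtain ⟨p, hp, hpx⟩ := Finset.mem_image.1 (hft x)
      obtain ⟨h1, h2⟩ := Finset.mem_filter.1 hp
      have : p = (x, φ x) := Prod.ext h2 hpx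
      rwa [← this]
    obtain ⟨π, hπ, hπd⟩ := ih (G.filter (fun p => p.2 ≠ φ p.1)) (fun x => by
        have h1 := hX x
        have : G.filter (fun p => p.1 = x) =
            insert (x, φ x) ((G.filter (fun p => p.2 ≠ φ p.1)).filter (fun p => p.1 = x)) := by
          ext ⟨a, b⟩
          have := hφG x
          simp only [Finset.mem_filter, Finset.mem_insert, Prod.mk.injEq]
          constructor
          · rintro ⟨h, rfl⟩; by_cases hb : b = φ a <;> simp_all
          · rintro (⟨rfl, rfl⟩ | ⟨⟨h, _⟩, rfl⟩) <;> simp_all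
        rw [this, Finset.card_insert_of_notMem (by simp)] at h1
        omega) (fun y => by
        have h1 := hY y
        have : G.filter (fun p => p.2 = y) =
            insert (φ.symm y, y)
              ((G.filter (fun p => p.2 ≠ φ p.1)).filter (fun p => p.2 = y)) := by
          ext ⟨a, b⟩
          have := hφG (φ.symm y)
          rw [Equiv.apply_symm_apply] at this
          simp only [Finset.mem_filter, Finset.mem_insert, Prod.mk.injEq]
          constructor
          · rintro ⟨h, rfl⟩
            by_cases hb : b = φ a
            · left; simp [hb]
            · right; exact ⟨⟨h, hb⟩, rfl⟩
          · rintro (⟨rfl, rfl⟩ | ⟨⟨h, _⟩, rfl⟩)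
            · exact ⟨this, rfl⟩
            · exact ⟨h, rfl⟩
        rw [this, Finset.card_insert_of_notMem (by simp)] at h1
        omega)
    refine ⟨Fin.cons φ π, fun s x => ?_, fun s s' => ?_⟩
    · refine Fin.cases ?_ (fun s => ?_) s
      · exact hφG x
      · exact (Finset.mem_filter.1 (hπ s x)).1
    · refine Fin.cases ?_ (fun s => ?_) s <;> refine Fin.cases ?_ (fun s' => ?_) s'
      · intro h; exact absurd rfl h
      · intro _ x; exact fun h => (Finset.mem_filter.1 (hπ s' x)).2 h.symm
      · intro _ x; exact (Finset.mem_filter.1 (hπ s x)).2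
      · intro h x; exact hπd s s' (fun e => h (by rw [e])) x

/-! ### The Ore–Ryser condition from degree and codegree bounds. -/

/-- Cauchy–Schwarz over `S`, applied to the degrees into `U`. The sum of squared degrees counts
pairs in `U` with a common neighbour in `S`: the diagonal pairs give the edge count itself, and the
others are controlled by the codegree bound. -/
theorem sq_card_between_le {α : Type*} [DecidableEq α] (G : Finset (α × α))
    (C : ℝ) (hC : 0 ≤ C) [Fintype α]
    (hcod : ∀ y y', y ≠ y' →
      ((Finset.univ.filter (fun x => (x, y) ∈ G ∧ (x, y') ∈ G)).card : ℝ) ≤ C) (S U : Finset α) :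
    ((G.filter (fun p => p.1 ∈ S ∧ p.2 ∈ U)).card : ℝ) ^ 2 ≤
      S.card * ((G.filter (fun p => p.1 ∈ S ∧ p.2 ∈ U)).card + U.card ^ 2 * C) := by
  set a : α → α → ℝ := fun x y => if (x, y) ∈ G then 1 else 0 with ha
  have hQ : ((G.filter (fun p => p.1 ∈ S ∧ p.2 ∈ U)).card : ℝ) = ∑ x ∈ S, ∑ y ∈ U, a x y := by
    rw [← Finset.sum_product']
    have : G.filter (fun p => p.1 ∈ S ∧ p.2 ∈ U) = (S ×ˢ U).filter (fun p => p ∈ G) := by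
      ext p; simp only [Finset.mem_filter, Finset.mem_product]; tauto
    rw [this, Finset.card_filter]
    push_cast
    rfl
  have hd : ∑ x ∈ S, (∑ y ∈ U, a x y) ^ 2 ≤ (∑ x ∈ S, ∑ y ∈ U, a x y) + U.card ^ 2 * C := by
    have h1 : ∑ x ∈ S, (∑ y ∈ U, a x y) ^ 2 =
        ∑ y ∈ U, ∑ y' ∈ U, ∑ x ∈ S, a x y * a x y' := by
      simp_rw [sq, Finset.sum_mul_sum]
      rw [Finset.sum_comm]
      exact Finset.sum_congr rfl fun y _ => Finset.sum_comm
    have h2 : ∀ y y', ∑ x ∈ S, a x y * a x y' ≤ (if y = y' then ∑ x ∈ S, a x y else 0) + C := by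
      intro y y'
      split_ifs with h
      · subst h
        have : ∀ x, a x y * a x y = a x y := fun x => by simp only [ha]; split_ifs <;> simp
        simp only [this]; linarith
      · rw [zero_add]
        refine le_trans ?_ (hcod y y' h)
        rw [Finset.card_filter]
        push_cast
        refine le_trans (Finset.sum_le_sum_of_subset_of_nonneg (Finset.subset_univ S)
          fun x _ _ => ?_) (Finset.sum_le_sum fun x _ => ?_)
        · simp only [ha]; split_ifs <;> simp
        · simp only [ha]; split_ifs <;> simp_all
    rw [h1]
    calc _ ≤ ∑ y ∈ U, ∑ y' ∈ U, ((if y = y' then ∑ x ∈ S, a x y else 0) + C) :=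
          Finset.sum_le_sum fun y _ => Finset.sum_le_sum fun y' _ => h2 y y'
      _ = ∑ y ∈ U, (∑ x ∈ S, a x y + U.card * C) := by
          refine Finset.sum_congr rfl fun y hy => ?_
          rw [Finset.sum_add_distrib, Finset.sum_ite_eq, if_pos hy]; simp
      _ = _ := by
          rw [Finset.sum_add_distrib, Finset.sum_comm]; simp; ring
  rw [hQ]
  refine sq_sum_le_card_mul_sum_sq.trans ?_
  gcongr

/-- The numerical core of the Ore–Ryser check. After the nonnegative term (s+u)(Ds)² is dropped, the
difference of the two sides is `u` times the quadratic form in `key`. -/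
theorem ore_cubic_inequality {ε s u : ℝ} (hε : 0 < ε) (hε' : ε ≤ 1 / 8) (hu : 0 ≤ u) (hus : u ≤ s) :
    (1 + 5 / 4 * ε) * (s * u ^ 2) ≤ (s + u) * (23 / 8 * ε * s + (1 - 4 * ε) * u) ^ 2 := by
  set c := 1 - 4 * ε with hc
  set D := 23 / 8 * ε with hD
  have hs : 0 ≤ s := hu.trans hus
  have hc0 : 1 / 2 ≤ c := by rw [hc]; linarith
  have key : 0 ≤ 2 * D * c * s ^ 2 + c ^ 2 * u ^ 2 +
      (2 * D * c + c ^ 2 - (1 + 5 / 4 * ε)) * (s * u) := by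
    have hsu : 0 ≤ s * u := mul_nonneg hs hu
    -- Replacing s² by su leaves the coefficient 9ε/4 - 30ε², nonnegative exactly up to ε = 3/40.
    -- Beyond that AM–GM on the two square terms is used instead, with 547/1000 and 587/1000 as
    -- lower approximations to √(2Dc) on the two subintervals.
    rcases le_total ε (3 / 40) with h | h
    · have h1 : 0 ≤ 4 * D * c + c ^ 2 - (1 + 5 / 4 * ε) := by
        rw [hc, hD]; nlinarith
      have h2 : 0 ≤ 2 * D * c := by rw [hD]; positivity
      nlinarith [mul_nonneg h2 (mul_nonneg hs (sub_nonneg.2 hus)), mul_nonneg h1 hsu,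
        mul_nonneg (sq_nonneg c) (sq_nonneg u)]
    · rcases le_total ε (1 / 10) with h' | h'
      · have h2 : (547 / 1000) ^ 2 ≤ 2 * D * c := by rw [hc, hD]; nlinarith
        have h1 : 0 ≤ 2 * (547 / 1000) * c + 2 * D * c + c ^ 2 - (1 + 5 / 4 * ε) := by
          rw [hc, hD]; nlinarith
        nlinarith [mul_nonneg h1 hsu, sq_nonneg (c * u - 547 / 1000 * s),
          mul_nonneg (sub_nonneg.2 h2) (sq_nonneg s)]
      · have h2 : (587 / 1000) ^ 2 ≤ 2 * D * c := by rw [hc, hD]; nlinarith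
        have h1 : 0 ≤ 2 * (587 / 1000) * c + 2 * D * c + c ^ 2 - (1 + 5 / 4 * ε) := by
          rw [hc, hD]; nlinarith
        nlinarith [mul_nonneg h1 hsu, sq_nonneg (c * u - 587 / 1000 * s),
          mul_nonneg (sub_nonneg.2 h2) (sq_nonneg s)]
  have h3 : 0 ≤ (s + u) * (D * s) ^ 2 := by positivity
  nlinarith [mul_nonneg hu key]

/-- For r ≤ (1-4ε)M the right side is at least Z = M(23ε/8·s + (1-4ε)u), where 23/8 = 4 - 9/8. If Q
exceeded Z, then Q would be at least 16s/ε, so the linear term sQ would be absorbed into Q² at the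
cost of a factor 1 - ε/16. The cubic inequality then contradicts the hypothesis, since (1 - ε/16)(1
+ 5ε/4) exceeds 1 + 9ε/8. -/
theorem card_between_le_of_sq_le {ε M ν s u Q r : ℝ} (hε : 0 < ε) (hε' : ε ≤ 1 / 8)
    (hM : 16 ≤ M * ε ^ 2) (hu : 0 ≤ u) (hus : u < s) (hsν : s + u ≤ ν)
    (hr : r ≤ (1 - 4 * ε) * M)
    (hQ : Q ^ 2 ≤ s * (Q + u ^ 2 * ((1 + 9 / 8 * ε) * M ^ 2 / ν))) :
    Q ≤ (1 - 9 / 8 * ε) * M * s - r * (s - u) := by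
  have hs : 0 < s := hu.trans_lt hus
  have hν : 0 < ν := by linarith
  have hM0 : 0 < M := by
    by_contra h
    nlinarith [mul_nonneg (neg_nonneg.2 (not_lt.1 h)) (sq_nonneg ε)]
  set Z := M * (23 / 8 * ε * s + (1 - 4 * ε) * u) with hZ
  have hZle : Z ≤ (1 - 9 / 8 * ε) * M * s - r * (s - u) := by
    rw [hZ]; nlinarith [mul_le_mul_of_nonneg_right hr (sub_nonneg.2 hus.le)]
  refine le_trans ?_ hZle
  by_contra! hlt
  have hZs : 16 * s ≤ Z * ε := by
    rw [hZ]
    have h1 : 16 * s ≤ M * ε ^ 2 * s := by gcongr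
    have h2 : 0 ≤ M * ε * ((1 - 4 * ε) * u) := by
      have : 0 ≤ 1 - 4 * ε := by linarith
      positivity
    have h3 : 0 ≤ M * ε ^ 2 * s := by positivity
    nlinarith
  have hQs : 16 * s ≤ Q * ε := hZs.trans (by gcongr)
  have hZ0 : 0 < Z := by
    by_contra h
    nlinarith [mul_nonneg (neg_nonneg.2 (not_lt.1 h)) hε.le]
  have h1 : Q ^ 2 * (1 - ε / 16) ≤ s * (u ^ 2 * ((1 + 9 / 8 * ε) * M ^ 2 / ν)) := by nlinarith
  have h2 : Z ^ 2 * (1 - ε / 16) < s * (u ^ 2 * ((1 + 9 / 8 * ε) * M ^ 2 / ν)) := by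
    refine lt_of_lt_of_le ?_ h1
    have : 0 < 1 - ε / 16 := by linarith
    gcongr
  have h3 : s * (u ^ 2 * ((1 + 9 / 8 * ε) * M ^ 2 / ν)) * ν =
      M ^ 2 * ((1 + 9 / 8 * ε) * (s * u ^ 2)) := by field_simp
  have h4 : Z ^ 2 * (1 - ε / 16) * ν < M ^ 2 * ((1 + 9 / 8 * ε) * (s * u ^ 2)) := by
    rw [← h3]; gcongr
  have h5 : Z ^ 2 * (1 - ε / 16) * ν = M ^ 2 * ((1 - ε / 16) *
      (ν * (23 / 8 * ε * s + (1 - 4 * ε) * u) ^ 2)) := by rw [hZ]; ring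
  rw [h5] at h4
  have h6 := lt_of_mul_lt_mul_left h4 (by positivity)
  have h7 := ore_cubic_inequality hε hε' hu hus.le
  have h8 : (1 + 5 / 4 * ε) * (s * u ^ 2) ≤ ν * (23 / 8 * ε * s + (1 - 4 * ε) * u) ^ 2 :=
    h7.trans (by gcongr)
  have h9 : (1 - ε / 16) * ((1 + 5 / 4 * ε) * (s * u ^ 2)) ≤
      (1 - ε / 16) * (ν * (23 / 8 * ε * s + (1 - 4 * ε) * u) ^ 2) :=
    mul_le_mul_of_nonneg_left h8 (by linarith)
  have h10 : 0 ≤ s * u ^ 2 := by positivity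
  nlinarith [mul_nonneg h10 hε.le, mul_nonneg h10 (mul_nonneg hε.le (sub_nonneg.2 hε'))]

/-- The edges from `S` outside `U` are all edges leaving `S` minus those into `U`; row degrees bound
the former and codegrees the latter. The size restriction on `S` and `U` supplies s + u ≤ ν in the
numerical inequality. -/
theorem ore_condition_of_card_add_card_le {α : Type*} [Fintype α] [DecidableEq α]
    (G : Finset (α × α)) {ε M : ℝ} (hε : 0 < ε) (hε' : ε ≤ 1 / 8) (hM : 16 ≤ M * ε ^ 2)
    (hrow : ∀ x, (1 - 9 / 8 * ε) * M ≤ (G.filter (fun p => p.1 = x)).card)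
    (hcod : ∀ y y', y ≠ y' →
      ((Finset.univ.filter (fun x => (x, y) ∈ G ∧ (x, y') ∈ G)).card : ℝ) ≤
        (1 + 9 / 8 * ε) * M ^ 2 / Fintype.card α)
    (r : ℕ) (hr : (r : ℝ) ≤ (1 - 4 * ε) * M) (S U : Finset α)
    (hSU : S.card + U.card ≤ Fintype.card α) :
    r * S.card ≤ r * U.card + (G.filter (fun p => p.1 ∈ S ∧ p.2 ∉ U)).card := by
  rcases le_or_gt S.card U.card with h | h
  · exact (Nat.mul_le_mul_left r h).trans (Nat.le_add_right _ _)
  have hQ := sq_card_between_le G _ (by positivity) hcod S U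
  have h1 := card_between_le_of_sq_le hε hε' hM (Nat.cast_nonneg U.card)
    (show (U.card : ℝ) < S.card by exact_mod_cast h)
    (show (S.card : ℝ) + U.card ≤ Fintype.card α by exact_mod_cast hSU) hr hQ
  have h2 : (G.filter (fun p => p.1 ∈ S)).card =
      (G.filter (fun p => p.1 ∈ S ∧ p.2 ∈ U)).card +
      (G.filter (fun p => p.1 ∈ S ∧ p.2 ∉ U)).card := by
    rw [← Finset.card_filter_add_card_filter_not (s := G.filter (fun p => p.1 ∈ S))
      (fun p => p.2 ∈ U), Finset.filter_filter, Finset.filter_filter]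
  have h3 : (1 - 9 / 8 * ε) * M * S.card ≤ (G.filter (fun p => p.1 ∈ S)).card := by
    rw [← sum_card_fiber_eq G Prod.fst S]
    push_cast
    rw [mul_comm, ← nsmul_eq_mul]
    exact Finset.card_nsmul_le_sum _ _ _ fun x _ => hrow x
  have h4 : ((G.filter (fun p => p.1 ∈ S)).card : ℝ) =
      (G.filter (fun p => p.1 ∈ S ∧ p.2 ∈ U)).card +
      (G.filter (fun p => p.1 ∈ S ∧ p.2 ∉ U)).card := by exact_mod_cast h2
  have h5 : (r : ℝ) * S.card ≤ r * U.card + (G.filter (fun p => p.1 ∈ S ∧ p.2 ∉ U)).card := by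
    nlinarith
  exact_mod_cast h5

/-- A bipartite graph with lower bounds on degrees and upper bounds on codegrees contains almost
as many edge-disjoint perfect matchings as its degrees allow. -/
theorem exists_disjoint_perms_of_codegree_le {α : Type*} [Fintype α] [DecidableEq α]
    (G : Finset (α × α)) {ε M : ℝ} (hε : 0 < ε) (hε' : ε ≤ 1 / 8) (hM : 16 ≤ M * ε ^ 2)
    (hrow : ∀ x, (1 - 9 / 8 * ε) * M ≤ (Finset.univ.filter (fun y => (x, y) ∈ G)).card)
    (hcol : ∀ y, (1 - 9 / 8 * ε) * M ≤ (Finset.univ.filter (fun x => (x, y) ∈ G)).card)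
    (hcodX : ∀ x x', x ≠ x' →
      ((Finset.univ.filter (fun y => (x, y) ∈ G ∧ (x', y) ∈ G)).card : ℝ) ≤
        (1 + 9 / 8 * ε) * M ^ 2 / Fintype.card α)
    (hcodY : ∀ y y', y ≠ y' →
      ((Finset.univ.filter (fun x => (x, y) ∈ G ∧ (x, y') ∈ G)).card : ℝ) ≤
        (1 + 9 / 8 * ε) * M ^ 2 / Fintype.card α)
    (r : ℕ) (hr : (r : ℝ) ≤ (1 - 4 * ε) * M) :
    ∃ π : Fin r → Equiv.Perm α, (∀ s x, (x, π s x) ∈ G) ∧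
      ∀ s s', s ≠ s' → ∀ x, π s x ≠ π s' x := by
  have hr1 : ∀ x, (Finset.univ.filter (fun y => (x, y) ∈ G)).card =
      (G.filter (fun p => p.1 = x)).card := fun x =>
    Finset.card_bij' (fun y _ => (x, y)) (fun p _ => p.2) (by simp)
      (by rintro ⟨a, b⟩ h; obtain ⟨h, rfl⟩ := Finset.mem_filter.1 h; simpa using h)
      (by simp) (by simp +contextual [eq_comm])
  have hc1 : ∀ y, (Finset.univ.filter (fun x => (x, y) ∈ G)).card =
      (G.filter (fun p => p.2 = y)).card := fun y =>
    Finset.card_bij' (fun x _ => (x, y)) (fun p _ => p.1) (by simp)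
      (by rintro ⟨a, b⟩ h; obtain ⟨h, rfl⟩ := Finset.mem_filter.1 h; simpa using h)
      (by simp) (by simp +contextual [eq_comm])
  have hc2 : ∀ y, (Finset.univ.filter (fun x => (x, y) ∈ G)).card =
      ((G.map (Equiv.prodComm α α).toEmbedding).filter (fun p => p.1 = y)).card := fun y => by
    rw [hc1, Finset.filter_map, Finset.card_map]; rfl
  have hswap : ∀ x y, (x, y) ∈ G.map (Equiv.prodComm α α).toEmbedding ↔ (y, x) ∈ G :=
    fun x y => by simp
  have hrpos : ∀ y, r ≤ (G.filter (fun p => p.2 = y)).card := fun y => by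
    have h1 := hcol y
    rw [hc1] at h1
    have hM0 : 0 ≤ M := by
      by_contra h
      nlinarith [mul_nonneg (neg_nonneg.2 (not_le.1 h).le) (sq_nonneg ε)]
    have : (r : ℝ) ≤ (G.filter (fun p => p.2 = y)).card := by
      nlinarith [mul_nonneg hε.le hM0]
    exact_mod_cast this
  obtain ⟨G', hG', hX, hY⟩ := exists_regular_subgraph G r (fun S T => by
      rcases le_total (S.card + T.card) (Fintype.card α) with h | h
      · exact ore_condition_of_card_add_card_le G hε hε' hM (fun x => by rw [← hr1]; exact hrow x)
          hcodY r hr S T h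
      -- When |S| + |T| is large, the condition for (S, T) is the same inequality as the condition
      -- for (Tᶜ, Sᶜ) in the transposed graph, where the sizes are small.
      · have h1 := ore_condition_of_card_add_card_le (G.map (Equiv.prodComm α α).toEmbedding)
          hε hε' hM (fun x => by rw [← hc2]; exact hcol x)
          (fun x x' hx => by simpa only [hswap] using hcodX x x' hx) r hr Tᶜ Sᶜ (by
            rw [Finset.card_compl, Finset.card_compl]
            have := S.card_le_univ
            have := T.card_le_univ
            omega)
        have h2 : ((G.map (Equiv.prodComm α α).toEmbedding).filter
            (fun p => p.1 ∈ Tᶜ ∧ p.2 ∉ Sᶜ)).card =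
            (G.filter (fun p => p.1 ∈ S ∧ p.2 ∉ T)).card := by
          rw [Finset.filter_map, Finset.card_map]
          congr 1
          refine Finset.filter_congr fun p _ => ?_
          simp [and_comm]
        rw [h2, Finset.card_compl, Finset.card_compl] at h1
        have h3 := S.card_le_univ
        have h4 := T.card_le_univ
        have e1 : r * (Fintype.card α - T.card) + r * T.card = r * Fintype.card α := by
          rw [← mul_add, Nat.sub_add_cancel h4]
        have e2 : r * (Fintype.card α - S.card) + r * S.card = r * Fintype.card α := by
          rw [← mul_add, Nat.sub_add_cancel h3]
        omega) hrpos
  obtain ⟨π, h1, h2⟩ := exists_perms_of_regular r G' hX hY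
  exact ⟨π, fun s x => hG' (h1 s x), h2⟩

/-! ### Random samples and random colourings by exponential moments. -/

/-- Among `N` independent uniform samples from `G` no event occurs more than `K` times, with
positive probability. -/
theorem exists_tuple_card_le {Ω ι : Type*} [Fintype ι] (G : Finset Ω)
    (hG : G.Nonempty) (A : ι → Ω → Prop) [∀ e, DecidablePred (A e)] (N K : ℕ) (q l : ℝ)
    (hl : 0 ≤ l)
    (hA : ∀ e, ((G.filter (A e)).card : ℝ) ≤ q * G.card)
    (h : Fintype.card ι * Real.exp (N * (q * (Real.exp l - 1)) - l * K) < 1) :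
    ∃ σ : Fin N → Ω, (∀ t, σ t ∈ G) ∧
      ∀ e, (Finset.univ.filter (fun t => A e (σ t))).card ≤ K := by
  classical
  by_contra! hcon
  set κ : ι → (Fin N → Ω) → ℕ := fun e σ => (Finset.univ.filter (fun t => A e (σ t))).card with hκ
  have hG0 : (0 : ℝ) < G.card := by exact_mod_cast hG.card_pos
  -- If every tuple violates some bound, then the exponential weights sum to at least 1 on every
  -- tuple. Averaging contradicts `h`.
  have h1 : ∀ σ ∈ Fintype.piFinset (fun _ : Fin N => G),
      (1 : ℝ) ≤ ∑ e, Real.exp (l * κ e σ) * Real.exp (-(l * K)) := by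
    intro σ hσ
    obtain ⟨e, he⟩ := hcon σ (fun t => Fintype.mem_piFinset.1 hσ t)
    refine le_trans ?_ (Finset.single_le_sum (f := fun e => Real.exp (l * κ e σ) *
      Real.exp (-(l * K))) (fun _ _ => by positivity) (Finset.mem_univ e))
    rw [← Real.exp_add, Real.one_le_exp_iff]
    have : (K : ℝ) ≤ κ e σ := by exact_mod_cast he.le
    nlinarith
  have h2 : ∀ e, ∑ σ ∈ Fintype.piFinset (fun _ : Fin N => G), Real.exp (l * κ e σ) ≤
      (G.card : ℝ) ^ N * Real.exp (N * (q * (Real.exp l - 1))) := by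
    intro e
    have e1 : ∀ σ : Fin N → Ω, Real.exp (l * κ e σ) =
        ∏ t, (if A e (σ t) then Real.exp l else 1) := fun σ => by
      rw [Finset.prod_ite, Finset.prod_const, Finset.prod_const_one, mul_one, ← Real.exp_nat_mul,
        mul_comm]
    have e2 : ∑ g ∈ G, (if A e g then Real.exp l else 1) ≤
        G.card * Real.exp (q * (Real.exp l - 1)) := by
      have : ∀ g, (if A e g then Real.exp l else 1) =
          1 + (Real.exp l - 1) * (if A e g then 1 else 0) := fun g => by split_ifs <;> ring
      rw [Finset.sum_congr rfl fun g _ => this g, Finset.sum_add_distrib, ← Finset.mul_sum,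
        Finset.sum_boole]
      have h3 := Real.add_one_le_exp (q * (Real.exp l - 1))
      have h4 : 0 ≤ Real.exp l - 1 := by
        have := Real.one_le_exp hl; linarith
      simp only [Finset.sum_const, nsmul_eq_mul, mul_one]
      nlinarith [mul_le_mul_of_nonneg_left (hA e) h4, mul_le_mul_of_nonneg_left h3 hG0.le]
    rw [Finset.sum_congr rfl fun σ _ => e1 σ, Finset.sum_prod_piFinset (g := fun _ g =>
      if A e g then Real.exp l else 1), Finset.prod_const, Finset.card_univ, Fintype.card_fin,
      Real.exp_nat_mul, ← mul_pow]
    refine pow_le_pow_left₀ (Finset.sum_nonneg fun g _ => by split_ifs <;> positivity) e2 N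
  have h3 : ((Fintype.piFinset (fun _ : Fin N => G)).card : ℝ) ≤
      ∑ σ ∈ Fintype.piFinset (fun _ : Fin N => G), ∑ e, Real.exp (l * κ e σ) *
        Real.exp (-(l * K)) := by
    have := Finset.card_nsmul_le_sum _ _ _ h1
    simpa using this
  rw [Finset.sum_comm] at h3
  simp only [← Finset.sum_mul] at h3
  have h4 : ∑ e, ∑ σ ∈ Fintype.piFinset (fun _ : Fin N => G), Real.exp (l * κ e σ) ≤
      Fintype.card ι * ((G.card : ℝ) ^ N * Real.exp (N * (q * (Real.exp l - 1)))) := by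
    refine (Finset.sum_le_sum fun e _ => h2 e).trans ?_
    simp
  have h5 : ((Fintype.piFinset (fun _ : Fin N => G)).card : ℝ) = (G.card : ℝ) ^ N := by
    simp
  have h6 : (G.card : ℝ) ^ N ≤ (G.card : ℝ) ^ N *
      (Fintype.card ι * Real.exp (N * (q * (Real.exp l - 1)) - l * K)) := by
    rw [h5] at h3
    calc _ ≤ _ := h3
      _ ≤ _ := mul_le_mul_of_nonneg_right h4 (Real.exp_pos _).le
      _ = _ := by rw [sub_eq_add_neg (N * (q * (Real.exp l - 1))), Real.exp_add]; ring
  have h7 : (0 : ℝ) < (G.card : ℝ) ^ N := by positivity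
  nlinarith

theorem card_colouring_prescribed {α : Type*} [Fintype α] [DecidableEq α] {K : ℕ} (U : Finset α)
    (c : α → Fin K) :
    (Finset.univ.filter (fun ω : α → Fin K => ∀ e ∈ U, ω e = c e)).card * K ^ U.card =
      K ^ Fintype.card α := by
  have h1 : Finset.univ.filter (fun ω : α → Fin K => ∀ e ∈ U, ω e = c e) =
      Fintype.piFinset (fun e => if e ∈ U then {c e} else Finset.univ) := by
    ext ω
    simp only [Finset.mem_filter, Finset.mem_univ, true_and, Fintype.mem_piFinset]
    refine forall_congr' fun e => ?_
    split_ifs with h <;> simp [h]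
  rw [h1, Fintype.card_piFinset]
  have h2 : ∀ e, (if e ∈ U then {c e} else Finset.univ : Finset (Fin K)).card =
      if e ∈ U then 1 else K := fun e => by split_ifs <;> simp
  rw [Finset.prod_congr rfl fun e _ => h2 e, Finset.prod_ite, Finset.prod_const_one, one_mul,
    Finset.prod_const, ← pow_add]
  congr 1
  rw [Finset.filter_not, Finset.filter_mem_eq_inter, Finset.univ_inter, ← Finset.compl_eq_univ_sdiff,
    Finset.card_compl, Nat.sub_add_cancel U.card_le_univ]

/-- Exponential moments of the number of monochromatic events for a uniform random colouring, when
the events live on disjoint sets of coordinates. -/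
theorem sum_exp_colouring_le {α β : Type*} [Fintype α] [DecidableEq α]
    {K : ℕ} (hK : 0 < K) (J : Finset β) (D : β → Finset α) (d : ℕ)
    (hD : ∀ j ∈ J, (D j).card = d)
    (hdisj : (J : Set β).PairwiseDisjoint D) (c : α → Fin K) (l : ℝ) :
    ∑ ω : α → Fin K, Real.exp (l * (J.filter (fun j => ∀ e ∈ D j, ω e = c e)).card) ≤
      (K : ℝ) ^ Fintype.card α * Real.exp ((Real.exp l - 1) * (J.card / (K : ℝ) ^ d)) := by
  classical
  have hK0 : (0 : ℝ) < K := by exact_mod_cast hK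
  set x := Real.exp l - 1 with hx
  -- The exponential is the product of factors 1 + x·1[event j], expanded over subsets of `J`.
  -- Disjointness gives a subset `t` probability K^(-d|t|), and the expansion resums to (1 +
  -- x/K^d)^|J|.
  have h1 : ∀ ω : α → Fin K, Real.exp (l * (J.filter (fun j => ∀ e ∈ D j, ω e = c e)).card) =
      ∑ t ∈ J.powerset, x ^ t.card * (if ∀ e ∈ t.biUnion D, ω e = c e then 1 else 0) := by
    intro ω
    have e1 : Real.exp (l * (J.filter (fun j => ∀ e ∈ D j, ω e = c e)).card) =
        ∏ j ∈ J, (1 + if ∀ e ∈ D j, ω e = c e then x else 0) := by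
      rw [mul_comm, Real.exp_nat_mul, ← Finset.prod_const, Finset.prod_filter]
      refine Finset.prod_congr rfl fun j _ => ?_
      split_ifs <;> simp [hx]
    rw [e1, Finset.prod_one_add]
    refine Finset.sum_congr rfl fun t _ => ?_
    split_ifs with h
    · rw [mul_one, ← Finset.prod_const]
      refine Finset.prod_congr rfl fun j hj => if_pos fun e he => ?_
      exact h e (Finset.mem_biUnion.2 ⟨j, hj, he⟩)
    · rw [mul_zero]
      push Not at h
      obtain ⟨e, he, hne⟩ := h
      obtain ⟨j, hj, hej⟩ := Finset.mem_biUnion.1 he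
      exact Finset.prod_eq_zero hj (if_neg fun hall => hne (hall e hej))
  have h2 : ∀ t ∈ J.powerset, ∑ ω : α → Fin K,
      (if ∀ e ∈ t.biUnion D, ω e = c e then (1 : ℝ) else 0) =
      (K : ℝ) ^ Fintype.card α * (1 / (K : ℝ) ^ d) ^ t.card := by
    intro t ht
    have ht' := Finset.mem_powerset.1 ht
    have e1 := card_colouring_prescribed (t.biUnion D) c
    have e2 : (t.biUnion D).card = d * t.card := by
      rw [Finset.card_biUnion (hdisj.subset (by exact_mod_cast ht')),
        Finset.sum_congr rfl fun j hj => hD j (ht' hj)]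
      simp [mul_comm]
    rw [e2] at e1
    rw [Finset.sum_boole, one_div, inv_pow, ← div_eq_mul_inv, eq_div_iff (by positivity), ← pow_mul]
    exact_mod_cast e1
  have h3 : ∑ ω : α → Fin K, Real.exp (l * (J.filter (fun j => ∀ e ∈ D j, ω e = c e)).card) =
      (K : ℝ) ^ Fintype.card α * (1 + x / (K : ℝ) ^ d) ^ J.card := by
    rw [Finset.sum_congr rfl fun ω _ => h1 ω, Finset.sum_comm, ← Finset.prod_const,
      Finset.prod_one_add, Finset.mul_sum]
    refine Finset.sum_congr rfl fun t ht => ?_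
    have : x / (K : ℝ) ^ d = x * (1 / (K : ℝ) ^ d) := div_eq_mul_one_div _ _
    rw [← Finset.mul_sum, h2 t ht, Finset.prod_const, this, mul_pow]
    exact mul_left_comm _ _ _
  rw [h3]
  gcongr
  have h4 : 0 ≤ 1 + x / (K : ℝ) ^ d := by
    have : (1 : ℝ) ≤ (K : ℝ) ^ d := one_le_pow₀ (by exact_mod_cast hK)
    have hx1 : -1 ≤ x := by have := Real.exp_pos l; rw [hx]; linarith
    have : -1 ≤ x / (K : ℝ) ^ d := by
      rw [le_div_iff₀ (by positivity)]; linarith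
    linarith
  calc (1 + x / (K : ℝ) ^ d) ^ J.card ≤ (Real.exp (x / (K : ℝ) ^ d)) ^ J.card := by
        gcongr; linarith [Real.add_one_le_exp (x / (K : ℝ) ^ d)]
    _ = _ := by rw [← Real.exp_nat_mul]; ring_nf

/-- A union bound over exponential moments. The sign of `l i` is left free, so one statement yields
upper tails (positive `l i`) and lower tails (negative `l i`) simultaneously. -/
theorem exists_colouring {α β ι : Type*} [Fintype α] [DecidableEq α] [Fintype ι]
    {K : ℕ} (hK : 0 < K) (J : ι → Finset β) (D : ι → β → Finset α) (d : ι → ℕ)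
    (hD : ∀ i, ∀ j ∈ J i, (D i j).card = d i)
    (hdisj : ∀ i, (J i : Set β).PairwiseDisjoint (D i)) (c : ι → α → Fin K) (l s : ι → ℝ) (η : ℝ)
    (h : ∀ i, (Real.exp (l i) - 1) * ((J i).card / (K : ℝ) ^ d i) - l i * s i ≤ -η)
    (hη : Fintype.card ι * Real.exp (-η) < 1) :
    ∃ ω : α → Fin K, ∀ i,
      l i * ((J i).filter (fun j => ∀ e ∈ D i j, ω e = c i e)).card ≤ l i * s i := by
  by_contra! hcon
  have hK0 : (0 : ℝ) < K := by exact_mod_cast hK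
  have h1 : ∀ ω : α → Fin K, (1 : ℝ) ≤ ∑ i,
      Real.exp (l i * ((J i).filter (fun j => ∀ e ∈ D i j, ω e = c i e)).card) *
        Real.exp (-(l i * s i)) := by
    intro ω
    obtain ⟨i, hi⟩ := hcon ω
    refine le_trans ?_ (Finset.single_le_sum (f := fun i =>
      Real.exp (l i * ((J i).filter (fun j => ∀ e ∈ D i j, ω e = c i e)).card) *
        Real.exp (-(l i * s i))) (fun _ _ => by positivity) (Finset.mem_univ i))
    rw [← Real.exp_add, Real.one_le_exp_iff]
    linarith
  have h2 := Finset.card_nsmul_le_sum Finset.univ _ _ fun ω _ => h1 ω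
  rw [Finset.sum_comm] at h2
  simp only [← Finset.sum_mul] at h2
  have h3 : ∑ i, (∑ ω : α → Fin K,
      Real.exp (l i * ((J i).filter (fun j => ∀ e ∈ D i j, ω e = c i e)).card)) *
        Real.exp (-(l i * s i)) ≤ ∑ _i : ι, (K : ℝ) ^ Fintype.card α * Real.exp (-η) := by
    refine Finset.sum_le_sum fun i _ => ?_
    refine (mul_le_mul_of_nonneg_right (sum_exp_colouring_le hK (J i) (D i) (d i) (hD i) (hdisj i)
      (c i) (l i)) (Real.exp_pos _).le).trans ?_
    rw [mul_assoc, ← Real.exp_add]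
    gcongr
    have := h i
    linarith
  have h4 := h2.trans h3
  simp only [Finset.card_univ, Fintype.card_fun, Fintype.card_fin, Finset.sum_const,
    nsmul_eq_mul, mul_one] at h4
  push_cast at h4
  have h5 : (0 : ℝ) < (K : ℝ) ^ Fintype.card α := by positivity
  nlinarith

/-- Random thinning by a factor `K` of a family of bipartite graphs approximately preserves lower
bounds on degrees and upper bounds on codegrees. -/
theorem exists_thinning {α γ ι : Type*} [Fintype α] [DecidableEq α] [Fintype ι]
    [Fintype γ] [DecidableEq γ] {K : ℕ} (hK : 0 < K) (E : Finset α) (e : ι → γ → γ → α)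
    (he : ∀ τ, ∀ i j i' j', e τ i j = e τ i' j' → i = i' ∧ j = j') (c : ι → α → Fin K)
    (d C θ X : ℝ) (hθ : 0 < θ) (hθ1 : θ ≤ 1)
    (hd : ∀ τ i, d ≤ (Finset.univ.filter (fun j => e τ i j ∈ E)).card)
    (hC : ∀ τ i i', i ≠ i' →
      ((Finset.univ.filter (fun j => e τ i j ∈ E ∧ e τ i' j ∈ E)).card : ℝ) ≤ C)
    (hX1 : X ≤ d / K) (hX2 : X ≤ C / K ^ 2) (hX0 : 0 ≤ X)
    (hX : Fintype.card ι * (Fintype.card γ : ℝ) ^ 2 * Real.exp (-(θ ^ 2 * X / 4)) < 1) :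
    ∃ ω : α → Fin K, ∀ τ,
      (∀ i, (1 - θ) * (d / K) ≤ (Finset.univ.filter (fun j =>
        e τ i j ∈ E ∧ ω (e τ i j) = c τ (e τ i j))).card) ∧
      (∀ i i', i ≠ i' → ((Finset.univ.filter (fun j =>
        (e τ i j ∈ E ∧ ω (e τ i j) = c τ (e τ i j)) ∧
        (e τ i' j ∈ E ∧ ω (e τ i' j) = c τ (e τ i' j)))).card : ℝ) ≤ (1 + θ) * (C / K ^ 2)) := by
  have hK0 : (0 : ℝ) < K := by exact_mod_cast hK
  have habs : ∀ x : ℝ, |x| ≤ 1 → Real.exp x - 1 ≤ x + x ^ 2 := fun x hx => by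
    have := Real.abs_exp_sub_one_sub_id_le hx
    have := (abs_le.1 this).2
    linarith
  -- Diagonal index pairs encode degrees (one edge per event, lower tail) and off-diagonal pairs
  -- encode codegrees (two edges per event, upper tail). With l = ∓θ/2 and exp x - 1 ≤ x + x², each
  -- exponent is at most -θ²X/4.
  obtain ⟨ω, hω⟩ := exists_colouring (ι := ι × γ × γ) (β := γ) (K := K) hK
    (fun p => Finset.univ.filter (fun j => e p.1 p.2.1 j ∈ E ∧ e p.1 p.2.2 j ∈ E))
    (fun p j => {e p.1 p.2.1 j, e p.1 p.2.2 j})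
    (fun p => if p.2.1 = p.2.2 then 1 else 2)
    (fun p j _ => by
      split_ifs with h
      · simp [h]
      · exact Finset.card_pair fun h' => h (he _ _ _ _ _ h').1)
    (fun p j _ j' _ hj => by
      refine Finset.disjoint_left.2 fun a ha ha' => ?_
      simp only [Finset.mem_insert, Finset.mem_singleton] at ha ha'
      rcases ha with rfl | rfl <;> rcases ha' with h | h <;> exact hj (he _ _ _ _ _ h).2)
    (fun p => c p.1) (fun p => if p.2.1 = p.2.2 then -(θ / 2) else θ / 2)
    (fun p => if p.2.1 = p.2.2 then (1 - θ) * (d / K) else (1 + θ) * (C / K ^ 2))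
    (θ ^ 2 * X / 4) (fun p => by
      obtain ⟨τ, i, i'⟩ := p
      dsimp only
      split_ifs with h
      · subst h
        simp only [and_self, pow_one]
        have h1 := habs (-(θ / 2)) (by rw [abs_neg, abs_of_pos (by positivity)]; linarith)
        have h2 : d / K ≤ (Finset.univ.filter (fun j => e τ i j ∈ E)).card / (K : ℝ) := by
          gcongr; exact hd τ i
        have hd0 : 0 ≤ d / K := hX0.trans hX1
        set y : ℝ := (Finset.univ.filter (fun j => e τ i j ∈ E)).card / (K : ℝ)
        have h3 : (Real.exp (-(θ / 2)) - 1) * y ≤ (-(θ / 2) + (-(θ / 2)) ^ 2) * y :=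
          mul_le_mul_of_nonneg_right h1 (hd0.trans h2)
        have h4 : (-(θ / 2) + (-(θ / 2)) ^ 2) * y ≤ (-(θ / 2) + (-(θ / 2)) ^ 2) * (d / K) :=
          mul_le_mul_of_nonpos_left h2 (by nlinarith)
        nlinarith [mul_le_mul_of_nonneg_left hX1 (sq_nonneg θ)]
      · have h1 := habs (θ / 2) (by rw [abs_of_pos (by positivity)]; linarith)
        have h2 : (Finset.univ.filter (fun j => e τ i j ∈ E ∧ e τ i' j ∈ E)).card / (K : ℝ) ^ 2
            ≤ C / K ^ 2 := by
          gcongr; exact hC τ i i' h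
        set y : ℝ := (Finset.univ.filter (fun j => e τ i j ∈ E ∧ e τ i' j ∈ E)).card / (K : ℝ) ^ 2
          with hy
        have hy0 : 0 ≤ y := by positivity
        have h3 : (Real.exp (θ / 2) - 1) * y ≤ (θ / 2 + (θ / 2) ^ 2) * y :=
          mul_le_mul_of_nonneg_right h1 hy0
        have h4 : (θ / 2 + (θ / 2) ^ 2) * y ≤ (θ / 2 + (θ / 2) ^ 2) * (C / K ^ 2) :=
          mul_le_mul_of_nonneg_left h2 (by positivity)
        nlinarith [mul_le_mul_of_nonneg_left hX2 (sq_nonneg θ)])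
    (by
      simp only [Fintype.card_prod]
      push_cast
      rw [← sq]
      exact hX)
  refine ⟨ω, fun τ => ⟨fun i => ?_, fun i i' hi => ?_⟩⟩
  · have h1 := hω (τ, i, i)
    simp only [if_true, and_self, Finset.pair_eq_singleton, Finset.mem_singleton, forall_eq,
      Finset.filter_filter] at h1
    nlinarith
  · have h1 := hω (τ, i, i')
    simp only [if_neg hi, Finset.mem_insert, Finset.mem_singleton, forall_eq_or_imp, forall_eq,
      Finset.filter_filter] at h1
    have h2 := le_of_mul_le_mul_left h1 (by positivity)
    refine le_of_eq_of_le ?_ h2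
    congr 2
    refine Finset.filter_congr fun j _ => ?_
    tauto

/-! ### Heads, bodies, links and candidate edges of an ordering. -/

/-- The first `a` positions of the `i`-th of `ν` consecutive intervals of length `ℓ`. -/
def headBlock (a : ℕ) {ν ℓ : ℕ} (i : Fin ν) : Finset (Fin (ν * ℓ)) :=
  Finset.univ.filter (fun x => x.divNat = i ∧ (x.modNat : ℕ) < a)

/-- All but the first `a` positions of the `i`-th of `ν` consecutive intervals of length `ℓ`. -/
def bodyBlock (a : ℕ) {ν ℓ : ℕ} (i : Fin ν) : Finset (Fin (ν * ℓ)) :=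
  Finset.univ.filter (fun x => x.divNat = i ∧ a ≤ (x.modNat : ℕ))

/-- The head of the `i`-th interval together with the head of its successor. -/
def linkBlock (a : ℕ) {ν ℓ : ℕ} (s : Perm (Fin ν)) (i : Fin ν) : Finset (Fin (ν * ℓ)) :=
  headBlock a i ∪ headBlock a (s i)

section
variable {a b ν : ℕ}

theorem mem_headBlock {ℓ : ℕ} {i : Fin ν} {x : Fin (ν * ℓ)} :
    x ∈ headBlock a i ↔ x.divNat = i ∧ (x.modNat : ℕ) < a := by
  rw [headBlock, Finset.mem_filter, and_iff_right (Finset.mem_univ x)]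

theorem mem_bodyBlock {ℓ : ℕ} {i : Fin ν} {x : Fin (ν * ℓ)} :
    x ∈ bodyBlock a i ↔ x.divNat = i ∧ a ≤ (x.modNat : ℕ) := by
  rw [bodyBlock, Finset.mem_filter, and_iff_right (Finset.mem_univ x)]

theorem card_headBlock (i : Fin ν) : (headBlock a i : Finset (Fin (ν * (a + b)))).card = a := by
  have : (headBlock a i : Finset (Fin (ν * (a + b)))) =
      (Finset.univ : Finset (Fin a)).image
        (fun j => finProdFinEquiv (i, Fin.castAdd b j)) := by
    ext x
    rw [mem_headBlock]
    simp only [Finset.mem_image, Finset.mem_univ, true_and]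
    constructor
    · rintro ⟨rfl, h⟩
      refine ⟨⟨x.modNat, h⟩, ?_⟩
      exact finProdFinEquiv.apply_symm_apply x
    · rintro ⟨j, rfl⟩
      have h : finProdFinEquiv.symm (finProdFinEquiv (i, Fin.castAdd b j)) = (i, Fin.castAdd b j) :=
        finProdFinEquiv.symm_apply_apply _
      have h1 := congrArg Prod.fst h
      have h2 := congrArg Prod.snd h
      refine ⟨h1, ?_⟩
      exact (congrArg Fin.val h2).trans_lt j.2
  rw [this, Finset.card_image_of_injective _ fun j j' h => ?_]
  · simp
  · simpa using h

theorem card_bodyBlock (i : Fin ν) : (bodyBlock a i : Finset (Fin (ν * (a + b)))).card = b := by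
  have : (bodyBlock a i : Finset (Fin (ν * (a + b)))) =
      (Finset.univ : Finset (Fin b)).image
        (fun j => finProdFinEquiv (i, Fin.natAdd a j)) := by
    ext x
    rw [mem_bodyBlock]
    simp only [Finset.mem_image, Finset.mem_univ, true_and]
    constructor
    · rintro ⟨rfl, h⟩
      refine ⟨⟨x.modNat - a, by have := x.modNat.2; omega⟩, ?_⟩
      refine Eq.trans (congrArg _ ?_) (finProdFinEquiv.apply_symm_apply x)
      refine Prod.ext rfl (Fin.ext ?_)
      change a + ((x.modNat : ℕ) - a) = x.modNat
      omega
    · rintro ⟨j, rfl⟩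
      have h : finProdFinEquiv.symm (finProdFinEquiv (i, Fin.natAdd a j)) = (i, Fin.natAdd a j) :=
        finProdFinEquiv.symm_apply_apply _
      have h1 := congrArg Prod.fst h
      have h2 := congrArg Prod.snd h
      refine ⟨h1, ?_⟩
      exact (Nat.le_add_right a j).trans_eq (congrArg Fin.val h2).symm
  rw [this, Finset.card_image_of_injective _ fun j j' h => ?_]
  · simp
  · simpa using h

theorem disjoint_headBlock {ℓ : ℕ} {i j : Fin ν} (h : i ≠ j) :
    Disjoint (headBlock a i : Finset (Fin (ν * ℓ))) (headBlock a j) :=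
  Finset.disjoint_left.2 fun _ h1 h2 => h ((mem_headBlock.1 h1).1.symm.trans (mem_headBlock.1 h2).1)

theorem disjoint_bodyBlock {ℓ : ℕ} {i j : Fin ν} (h : i ≠ j) :
    Disjoint (bodyBlock a i : Finset (Fin (ν * ℓ))) (bodyBlock a j) :=
  Finset.disjoint_left.2 fun _ h1 h2 => h ((mem_bodyBlock.1 h1).1.symm.trans (mem_bodyBlock.1 h2).1)

theorem disjoint_headBlock_bodyBlock {ℓ : ℕ} (i j : Fin ν) :
    Disjoint (headBlock a i : Finset (Fin (ν * ℓ))) (bodyBlock a j) :=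
  Finset.disjoint_left.2 fun _ h1 h2 =>
    (mem_headBlock.1 h1).2.not_ge (mem_bodyBlock.1 h2).2

theorem card_filter_mem_bodyBlock_le {ℓ : ℕ} (x : Fin (ν * ℓ)) :
    (Finset.univ.filter (fun j : Fin ν => x ∈ bodyBlock a j)).card ≤ 2 := by
  refine (Finset.card_le_card (t := {x.divNat}) fun j hj => ?_).trans (by simp)
  have := (mem_bodyBlock.1 (Finset.mem_filter.1 hj).2).1
  simp [this]

theorem card_filter_mem_linkBlock_le {ℓ : ℕ} (s : Perm (Fin ν)) (x : Fin (ν * ℓ)) :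
    (Finset.univ.filter (fun j : Fin ν => x ∈ linkBlock a s j)).card ≤ 2 := by
  refine (Finset.card_le_card (t := {x.divNat, s.symm x.divNat}) fun j hj => ?_).trans
    Finset.card_le_two
  rcases Finset.mem_union.1 (Finset.mem_filter.1 hj).2 with h | h
  · simp [(mem_headBlock.1 h).1]
  · simp [(mem_headBlock.1 h).1]

theorem card_linkBlock {s : Perm (Fin ν)} (hs : ∀ i, s i ≠ i) (i : Fin ν) :
    (linkBlock a s i : Finset (Fin (ν * (a + b)))).card = 2 * a := by
  rw [linkBlock, Finset.card_union_of_disjoint (disjoint_headBlock (hs i).symm), card_headBlock,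
    card_headBlock, two_mul]

theorem disjoint_linkBlock_bodyBlock {ℓ : ℕ} (s : Perm (Fin ν)) (i j : Fin ν) :
    Disjoint (linkBlock a s i : Finset (Fin (ν * ℓ))) (bodyBlock a j) :=
  Finset.disjoint_union_left.2
    ⟨disjoint_headBlock_bodyBlock _ _, disjoint_headBlock_bodyBlock _ _⟩

/-- Two links share a head only if one follows the other, and they cannot share both heads because
`s` has no 2-cycles. The sizes 0 and `a` are precisely those allowed in `Pf`. -/
theorem card_linkBlock_inter {s : Perm (Fin ν)} (hs : ∀ i, s i ≠ i) (hs' : ∀ i, s (s i) ≠ i)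
    {i j : Fin ν} (h : i ≠ j) :
    (linkBlock a s i ∩ linkBlock a s j : Finset (Fin (ν * (a + b)))).card = 0 ∨
    (linkBlock a s i ∩ linkBlock a s j : Finset (Fin (ν * (a + b)))).card = a := by
  by_cases h1 : s i = j
  · right
    refine Eq.trans (congrArg Finset.card ?_) (card_headBlock (b := b) j)
    ext x
    have := hs' i
    have := hs j
    simp only [linkBlock, Finset.mem_inter, Finset.mem_union, mem_headBlock, h1]
    grind
  by_cases h2 : s j = i
  · right
    refine Eq.trans (congrArg Finset.card ?_) (card_headBlock (b := b) i)
    ext x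
    have := hs' j
    have := hs i
    simp only [linkBlock, Finset.mem_inter, Finset.mem_union, mem_headBlock, h2]
    grind
  · left
    rw [Finset.card_eq_zero, Finset.eq_empty_iff_forall_notMem]
    intro x
    have := s.injective.ne h
    simp only [linkBlock, Finset.mem_inter, Finset.mem_union, mem_headBlock]
    grind

theorem headBlock_nonempty (ha : 0 < a) (i : Fin ν) :
    (headBlock a i : Finset (Fin (ν * (a + b)))).Nonempty :=
  Finset.card_pos.1 (by rwa [card_headBlock])

theorem bodyBlock_nonempty (hb : 0 < b) (i : Fin ν) :
    (bodyBlock a i : Finset (Fin (ν * (a + b)))).Nonempty :=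
  Finset.card_pos.1 (by rwa [card_bodyBlock])

/-- Head and body positions never mix, so the body index can be read off. The unordered pair {i, s
i} determines `i` because `s` has no 2-cycles. -/
theorem link_union_body_injective (ha : 0 < a) (hb : 0 < b) {s : Perm (Fin ν)}
    (hs' : ∀ i, s (s i) ≠ i) {i j i' j' : Fin ν}
    (h : (linkBlock a s i ∪ bodyBlock a j : Finset (Fin (ν * (a + b)))) =
      linkBlock a s i' ∪ bodyBlock a j') : i = i' ∧ j = j' := by
  have hmem := fun x => Finset.ext_iff.1 h x
  simp only [linkBlock, Finset.mem_union, mem_headBlock, mem_bodyBlock] at hmem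
  obtain ⟨x, hx⟩ := headBlock_nonempty (b := b) ha i
  obtain ⟨y, hy⟩ := headBlock_nonempty (b := b) ha (s i)
  obtain ⟨z, hz⟩ := bodyBlock_nonempty (a := a) hb j
  have h1 := hmem x
  have h2 := hmem y
  have h3 := hmem z
  rw [mem_headBlock] at hx hy
  rw [mem_bodyBlock] at hz
  have hs1 := hs' i
  have hs2 := hs' i'
  have hinj : s i = s i' → i = i' := fun h => s.injective h
  constructor
  · have e1 : i = i' ∨ i = s i' := by
      rcases h1.1 (Or.inl (Or.inl hx)) with (h | h) | h
      · left; exact hx.1.symm.trans h.1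
      · right; exact hx.1.symm.trans h.1
      · exact absurd h.2 hx.2.not_ge
    have e2 : s i = i' ∨ s i = s i' := by
      rcases h2.1 (Or.inl (Or.inr hy)) with (h | h) | h
      · left; exact hy.1.symm.trans h.1
      · right; exact hy.1.symm.trans h.1
      · exact absurd h.2 hy.2.not_ge
    rcases e2 with e2 | e2
    · rcases e1 with e1 | e1
      · exact e1
      · exact absurd (by rw [← e1, e2]) hs2
    · exact hinj e2
  · rcases h3.1 (Or.inr hz) with (h | h) | h
    · exact absurd hz.2 h.2.not_ge
    · exact absurd hz.2 h.2.not_ge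
    · exact hz.1.symm.trans h.1

end

/-- The candidate edge consisting of the `i`-th link block and the `j`-th body block of the
ordering `σ`. -/
def blockEdge (a : ℕ) {ν ℓ : ℕ} (s : Perm (Fin ν)) (σ : Perm (Fin (ν * ℓ))) (i j : Fin ν) :
    Finset (Fin (ν * ℓ)) :=
  (linkBlock a s i ∪ bodyBlock a j).image σ

theorem blockEdge_injective {a b ν : ℕ} (ha : 0 < a) (hb : 0 < b) {s : Perm (Fin ν)}
    (hs' : ∀ i, s (s i) ≠ i) (σ : Perm (Fin (ν * (a + b)))) (i j i' j' : Fin ν)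
    (h : blockEdge a s σ i j = blockEdge a s σ i' j') : i = i' ∧ j = j' :=
  link_union_body_injective ha hb hs' (Finset.image_injective σ.injective h)

theorem card_blockEdge {a b ν : ℕ} {s : Perm (Fin ν)}
    (hs : ∀ i, s i ≠ i) (σ : Perm (Fin (ν * (a + b)))) (i j : Fin ν) :
    (blockEdge a s σ i j).card = 2 * a + b := by
  rw [blockEdge, Finset.card_image_of_injective _ σ.injective,
    Finset.card_union_of_disjoint (disjoint_linkBlock_bodyBlock _ _ _), card_linkBlock hs,
    card_bodyBlock]

/-! ### Almost every ordering is regular. -/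

theorem mem_nbhd {k n : ℕ} {E : Finset (Finset (Fin n))} {X Y : Finset (Fin n)} :
    Y ∈ nbhd k E X ↔ Y.card = k - X.card ∧ X ∪ Y ∈ E := by
  simp [nbhd, Finset.mem_powersetCard]

theorem choose_le_choose_sub_add (n c c' : ℕ) (h : c' ≤ n) :
    n.choose (c + 1) ≤ (n - c').choose (c + 1) + c' * (n - 1).choose c := by
  induction c' with
  | zero => simp
  | succ c' ih =>
    have h1 := ih (by omega)
    have h2 : n - c' = (n - (c' + 1)) + 1 := by omega
    rw [h2, Nat.choose_succ_succ'] at h1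
    have h3 : (n - (c' + 1)).choose c ≤ (n - 1).choose c := Nat.choose_le_choose c (by omega)
    rw [Nat.succ_mul]
    omega

/-- Excluding c' vertices destroys at most c'·C(n-1, c-1) = (cc'/n)·C(n, c) sets. This compares the
binomials of `Pa` and `Pb` with the C(n, c) of the averaging argument. -/
theorem one_sub_mul_choose_le {n c c' : ℕ} (hc : 0 < c) (hc' : c' ≤ n) (hn : 0 < n) {x : ℝ}
    (hx : (c * c' : ℝ) ≤ x * n) :
    (1 - x) * (n.choose c : ℝ) ≤ ((n - c').choose c : ℝ) := by
  obtain ⟨c, rfl⟩ := Nat.exists_eq_succ_of_ne_zero hc.ne'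
  obtain ⟨m, rfl⟩ := Nat.exists_eq_succ_of_ne_zero hn.ne'
  have h1 : ((m + 1).choose (c + 1) : ℝ) ≤
      ((m + 1 - c').choose (c + 1) : ℝ) + c' * (m.choose c : ℝ) := by
    exact_mod_cast choose_le_choose_sub_add (m + 1) c c' hc'
  have h2 : ((m + 1 : ℕ) : ℝ) * (m.choose c : ℝ) = (m + 1).choose (c + 1) * ((c + 1 : ℕ) : ℝ) := by
    exact_mod_cast Nat.add_one_mul_choose_eq m c
  have hm : (0 : ℝ) < ((m + 1 : ℕ) : ℝ) := by positivity
  have h3 : c' * (m.choose c : ℝ) ≤ x * (m + 1).choose (c + 1) := by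
    refine le_of_mul_le_mul_left ?_ hm
    have : (0 : ℝ) ≤ ((m + 1).choose (c + 1) : ℝ) := by positivity
    calc ((m + 1 : ℕ) : ℝ) * (c' * (m.choose c : ℝ))
        = c' * (((m + 1 : ℕ) : ℝ) * (m.choose c : ℝ)) := by ring
      _ = (((c + 1 : ℕ) : ℝ) * c') * (m + 1).choose (c + 1) := by rw [h2]; ring
      _ ≤ (x * ((m + 1 : ℕ) : ℝ)) * (m + 1).choose (c + 1) := by gcongr
      _ = _ := by ring
  simp only [Nat.succ_eq_add_one] at *
  linarith

theorem mem_nbhd_of_card {k n : ℕ} {E : Finset (Finset (Fin n))} {X Y : Finset (Fin n)}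
    (h : X.card + Y.card = k) : Y ∈ nbhd k E X ↔ X ∪ Y ∈ E := by
  rw [mem_nbhd, and_iff_right]; omega

open scoped Classical in
/-- For all but few orderings, the blocks meet all neighbourhoods, and all intersections of two
neighbourhoods, in about the expected number. -/
theorem card_irregular_le {n ν k c c' : ℕ} (hn : 0 < n) (hcc : c + c' = k) (hc : 0 < c)
    (hk : k ≤ n) (D : Fin ν → Finset (Fin n)) (hDc : ∀ j, (D j).card = c)
    (hD : ∀ x, (Finset.univ.filter (fun j => x ∈ D j)).card ≤ 2) (E : Finset (Finset (Fin n)))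
    {ε p : ℝ} (hε : 0 < ε) (hε' : ε ≤ 1 / 8) (hp : 0 ≤ p) (hp1 : p ≤ 1)
    (hnε : (c * c' : ℝ) ≤ ε / 32 * n) (P : Finset (Fin n) → Finset (Fin n) → Prop)
    (hlow : ∀ S, S.card = c' → (1 - ε) * ((n - c').choose c : ℝ) * p ≤ deg k E S)
    (hup : ∀ S₁ S₂, S₁.card = c' → S₂.card = c' → P S₁ S₂ →
      ((nbhd k E S₁ ∩ nbhd k E S₂).card : ℝ) ≤ (1 + ε) * (n.choose c : ℝ) * p ^ 2) :
    ((Finset.univ.filter (fun σ : Perm (Fin n) => ¬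
      ((∀ S, S.card = c' → (1 - 17 / 16 * ε) * (ν * p) ≤ blockCount D (nbhd k E S) σ) ∧
      ∀ S₁ S₂, S₁.card = c' → S₂.card = c' → P S₁ S₂ →
        (blockCount D (nbhd k E S₁ ∩ nbhd k E S₂) σ : ℝ) ≤
          (1 + 17 / 16 * ε) * (ν * p ^ 2)))).card : ℝ) ≤
    2 * (n : ℝ) ^ (2 * k) * (n.factorial * Real.exp (-((ν * p ^ 2 * (ε / 32)) ^ 2 / (128 * n)))) := by
  set B : ℝ := n.factorial * Real.exp (-((ν * p ^ 2 * (ε / 32)) ^ 2 / (128 * n))) with hB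
  have hB0 : 0 ≤ B := by positivity
  have hcn : c ≤ n := by omega
  have hch : (0 : ℝ) < n.choose c := by exact_mod_cast Nat.choose_pos hcn
  have hn1 : (1 : ℝ) ≤ n := by exact_mod_cast hn
  have hF : ∀ S : Finset (Fin n), S.card = c' → ∀ Y ∈ nbhd k E S, Y.card = c := fun S hS Y hY => by
    have := (mem_nbhd.1 hY).1; omega
  -- The deviation allowed for both tails. For degrees the losses ε (hypothesis), ε/32 (binomial)
  -- and ε/32 (deviation) add up to 17ε/16.
  set t : ℝ := ν * p ^ 2 * (ε / 32) with ht
  have ht0 : 0 ≤ t := by positivity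
  have htp : t ≤ ν * p * (ε / 32) := by
    rw [ht]; gcongr; nlinarith
  have h1 : ∀ S, S.card = c' → ((Finset.univ.filter (fun σ : Perm (Fin n) =>
      (blockCount D (nbhd k E S) σ : ℝ) < (1 - 17 / 16 * ε) * (ν * p))).card : ℝ) ≤ B := by
    intro S hS
    refine card_blockCount_le_le hn hcn D hDc hD _ (hF S hS) _ t ht0 ?_
    rw [le_div_iff₀ hch]
    have e1 := hlow S hS
    have e2 := one_sub_mul_choose_le (n := n) (c := c) (c' := c') hc (by omega) hn hnε
    have e3 : (1 - ε) * ((1 - ε / 32) * (n.choose c : ℝ)) * p ≤ (nbhd k E S).card := by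
      refine le_trans ?_ e1
      gcongr
      linarith
    have hνp : 0 ≤ (ν : ℝ) * p := by positivity
    have e4 : ((1 - 17 / 16 * ε) * (ν * p) + t) ≤ (1 - ε) * (1 - ε / 32) * (ν * p) := by
      nlinarith [mul_nonneg hνp hε.le, mul_nonneg hνp (sq_nonneg ε)]
    calc _ ≤ (1 - ε) * (1 - ε / 32) * (ν * p) * n.choose c := by gcongr
      _ = ν * ((1 - ε) * ((1 - ε / 32) * (n.choose c : ℝ)) * p) := by ring
      _ ≤ _ := by gcongr
  have h2 : ∀ S₁ S₂, S₁.card = c' → S₂.card = c' → P S₁ S₂ →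
      ((Finset.univ.filter (fun σ : Perm (Fin n) => (1 + 17 / 16 * ε) * (ν * p ^ 2) <
        (blockCount D (nbhd k E S₁ ∩ nbhd k E S₂) σ : ℝ))).card : ℝ) ≤ B := by
    intro S₁ S₂ hS₁ hS₂ hP
    refine card_blockCount_ge_le hn hcn D hDc hD _
      (fun Y hY => hF S₁ hS₁ Y (Finset.mem_inter.1 hY).1) _ t ht0 ?_
    have e1 := hup S₁ S₂ hS₁ hS₂ hP
    have e2 : (ν : ℝ) * (nbhd k E S₁ ∩ nbhd k E S₂).card / n.choose c ≤
        (1 + ε) * (ν * p ^ 2) := by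
      rw [div_le_iff₀ hch]
      calc _ ≤ (ν : ℝ) * ((1 + ε) * (n.choose c : ℝ) * p ^ 2) := by gcongr
        _ = _ := by ring
    have hνp : 0 ≤ (ν : ℝ) * p ^ 2 := by positivity
    rw [ht]
    nlinarith [mul_nonneg hνp hε.le]
  set 𝒮 := Finset.powersetCard c' (Finset.univ : Finset (Fin n)) with h𝒮
  have hcard : (𝒮.card : ℝ) ≤ (n : ℝ) ^ k := by
    rw [h𝒮, Finset.card_powersetCard, Finset.card_univ, Fintype.card_fin]
    have e1 : n.choose c' ≤ n ^ c' := Nat.choose_le_pow n c'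
    have e2 : n ^ c' ≤ n ^ k := Nat.pow_le_pow_right hn (by omega)
    exact_mod_cast e1.trans e2
  have hsub : Finset.univ.filter (fun σ : Perm (Fin n) => ¬
      ((∀ S, S.card = c' → (1 - 17 / 16 * ε) * (ν * p) ≤ blockCount D (nbhd k E S) σ) ∧
      ∀ S₁ S₂, S₁.card = c' → S₂.card = c' → P S₁ S₂ →
        (blockCount D (nbhd k E S₁ ∩ nbhd k E S₂) σ : ℝ) ≤
          (1 + 17 / 16 * ε) * (ν * p ^ 2))) ⊆
      (𝒮.biUnion fun S => Finset.univ.filter (fun σ : Perm (Fin n) =>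
        (blockCount D (nbhd k E S) σ : ℝ) < (1 - 17 / 16 * ε) * (ν * p))) ∪
      (((𝒮 ×ˢ 𝒮).filter (fun q => P q.1 q.2)).biUnion fun q =>
        Finset.univ.filter (fun σ : Perm (Fin n) => (1 + 17 / 16 * ε) * (ν * p ^ 2) <
        (blockCount D (nbhd k E q.1 ∩ nbhd k E q.2) σ : ℝ))) := by
    intro σ hσ
    have hσ := (Finset.mem_filter.1 hσ).2
    rw [not_and_or] at hσ
    rw [Finset.mem_union]
    rcases hσ with hσ | hσ
    · left
      push Not at hσ
      obtain ⟨S, hS, h⟩ := hσ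
      exact Finset.mem_biUnion.2 ⟨S, Finset.mem_powersetCard.2 ⟨Finset.subset_univ _, hS⟩,
        Finset.mem_filter.2 ⟨Finset.mem_univ _, h⟩⟩
    · right
      push Not at hσ
      obtain ⟨S₁, S₂, hS₁, hS₂, hP, h⟩ := hσ
      exact Finset.mem_biUnion.2 ⟨(S₁, S₂), Finset.mem_filter.2 ⟨Finset.mem_product.2
        ⟨Finset.mem_powersetCard.2 ⟨Finset.subset_univ _, hS₁⟩,
        Finset.mem_powersetCard.2 ⟨Finset.subset_univ _, hS₂⟩⟩, hP⟩,
        Finset.mem_filter.2 ⟨Finset.mem_univ _, h⟩⟩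
  have hb1 : ((𝒮.biUnion fun S => Finset.univ.filter (fun σ : Perm (Fin n) =>
        (blockCount D (nbhd k E S) σ : ℝ) < (1 - 17 / 16 * ε) * (ν * p))).card : ℝ) ≤
        (n : ℝ) ^ k * B := by
    refine (Nat.cast_le.2 Finset.card_biUnion_le).trans ?_
    push_cast
    refine (Finset.sum_le_card_nsmul _ _ B fun S hS => h1 S (Finset.mem_powersetCard.1 hS).2).trans ?_
    rw [nsmul_eq_mul]
    gcongr
  have hb2 : ((((𝒮 ×ˢ 𝒮).filter (fun q => P q.1 q.2)).biUnion fun q =>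
        Finset.univ.filter (fun σ : Perm (Fin n) => (1 + 17 / 16 * ε) * (ν * p ^ 2) <
        (blockCount D (nbhd k E q.1 ∩ nbhd k E q.2) σ : ℝ))).card : ℝ) ≤
        (n : ℝ) ^ (2 * k) * B := by
    refine (Nat.cast_le.2 Finset.card_biUnion_le).trans ?_
    push_cast
    refine (Finset.sum_le_card_nsmul _ _ B fun q hq => ?_).trans ?_
    · obtain ⟨hq1, hq2⟩ := Finset.mem_filter.1 hq
      obtain ⟨hq3, hq4⟩ := Finset.mem_product.1 hq1
      exact h2 _ _ (Finset.mem_powersetCard.1 hq3).2 (Finset.mem_powersetCard.1 hq4).2 hq2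
    · rw [nsmul_eq_mul]
      gcongr
      have e1 : (((𝒮 ×ˢ 𝒮).filter (fun q => P q.1 q.2)).card : ℝ) ≤ (𝒮.card : ℝ) * 𝒮.card := by
        exact_mod_cast (Finset.card_filter_le _ _).trans_eq (Finset.card_product _ _)
      refine e1.trans ?_
      rw [two_mul, pow_add]
      gcongr
  refine (Nat.cast_le.2 ((Finset.card_le_card hsub).trans (Finset.card_union_le _ _))).trans ?_
  push_cast
  have h3 : (n : ℝ) ^ k ≤ (n : ℝ) ^ (2 * k) := pow_le_pow_right₀ hn1 (by omega)
  nlinarith [mul_le_mul_of_nonneg_right h3 hB0]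

/-- An ordering is regular if the bipartite graph of candidate edges that lie in `E` has large
degrees and small codegrees. -/
structure IsRegularOrder (a : ℕ) {ν ℓ : ℕ} (s : Perm (Fin ν)) (E : Finset (Finset (Fin (ν * ℓ))))
    (ε p : ℝ) (σ : Perm (Fin (ν * ℓ))) : Prop where
  deg_link : ∀ i, (1 - 17 / 16 * ε) * (ν * p) ≤
    (Finset.univ.filter (fun j => blockEdge a s σ i j ∈ E)).card
  deg_body : ∀ j, (1 - 17 / 16 * ε) * (ν * p) ≤
    (Finset.univ.filter (fun i => blockEdge a s σ i j ∈ E)).card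
  codeg_link : ∀ i i', i ≠ i' → ((Finset.univ.filter
    (fun j => blockEdge a s σ i j ∈ E ∧ blockEdge a s σ i' j ∈ E)).card : ℝ) ≤
      (1 + 17 / 16 * ε) * (ν * p ^ 2)
  codeg_body : ∀ j j', j ≠ j' → ((Finset.univ.filter
    (fun i => blockEdge a s σ i j ∈ E ∧ blockEdge a s σ i j' ∈ E)).card : ℝ) ≤
      (1 + 17 / 16 * ε) * (ν * p ^ 2)

theorem density_nonneg (k : ℕ) {n : ℕ} (E : Finset (Finset (Fin n))) : 0 ≤ density k E := by
  unfold density; positivity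

theorem density_le_one {k n : ℕ} {E : Finset (Finset (Fin n))}
    (hE : (E : Set (Finset (Fin n))).Sized k) : density k E ≤ 1 := by
  refine div_le_one_of_le₀ ?_ (by positivity)
  have : E.card ≤ (Finset.powersetCard k (Finset.univ : Finset (Fin n))).card :=
    Finset.card_le_card fun S hS => Finset.mem_powersetCard.2 ⟨Finset.subset_univ _, hE hS⟩
  rw [Finset.card_powersetCard, Finset.card_univ, Fintype.card_fin] at this
  exact_mod_cast this

-- Fixing a link and counting bodies uses `Pa` and `Pf`; fixing a body and counting links uses `Pb`
-- and `Pe`. Each of the two counts is one application of `card_irregular_le`, with the roles of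
-- link and body exchanged.
open scoped Classical in
theorem card_not_isRegularOrder_le {a b ν : ℕ} (ha : 0 < a) (hb : 0 < b)
    (hk : 2 * a + b ≤ ν * (a + b)) {s : Perm (Fin ν)} (hs : ∀ i, s i ≠ i) (hs' : ∀ i, s (s i) ≠ i)
    (E : Finset (Finset (Fin (ν * (a + b)))))
    (hE : (E : Set (Finset (Fin (ν * (a + b))))).Sized (2 * a + b))
    {ε : ℝ} (hε : 0 < ε) (hε' : ε ≤ 1 / 8)
    (hnε : (2 * a * b : ℝ) ≤ ε / 32 * (ν * (a + b) : ℕ))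
    (hP : PseudoRandom (2 * a + b) (a + b) ε E) :
    ((Finset.univ.filter (fun σ => ¬ IsRegularOrder a s E ε (density (2 * a + b) E) σ)).card : ℝ) ≤
    4 * ((ν * (a + b) : ℕ) : ℝ) ^ (2 * (2 * a + b)) * ((ν * (a + b)).factorial *
      Real.exp (-((ν * density (2 * a + b) E ^ 2 * (ε / 32)) ^ 2 / (128 * (ν * (a + b) : ℕ))))) := by
  set p := density (2 * a + b) E with hp
  have hn0 : 0 < ν * (a + b) := by omega
  have hp0 : 0 ≤ p := density_nonneg _ _
  have hp1 : p ≤ 1 := density_le_one hE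
  have e2 : 2 * (a + b) - (2 * a + b) = b := by omega
  have e3 : 2 * a + b - (a + b) = a := by omega
  obtain ⟨Pa, Pb, -, -, Pe, Pf⟩ := hP
  simp only [e2, e3] at Pa Pb Pe Pf
  have h1 := card_irregular_le (n := ν * (a + b)) (ν := ν) (k := 2 * a + b) (c := b) (c' := 2 * a) hn0
    (by omega) hb hk (bodyBlock a) (fun j => card_bodyBlock j) card_filter_mem_bodyBlock_le E
    hε hε' hp0 hp1 (by push_cast at hnε ⊢; linarith)
    (fun S₁ S₂ => (S₁ ∩ S₂).card = 0 ∨ (S₁ ∩ S₂).card = a)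
    (fun S hS => Nat.ceil_le.1 (Pa S hS)) (fun S₁ S₂ h1 h2 h3 =>
      (Nat.le_floor_iff (by positivity)).1 (Pf S₁ S₂ h1 h2 h3))
  have h2 := card_irregular_le (n := ν * (a + b)) (ν := ν) (k := 2 * a + b) (c := 2 * a) (c' := b) hn0
    (by omega) (by omega) hk (linkBlock a s) (fun j => card_linkBlock hs j)
    (card_filter_mem_linkBlock_le s) E
    hε hε' hp0 hp1 (by push_cast at hnε ⊢; linarith)
    (fun S₁ S₂ => S₁ ∩ S₂ = ∅)
    (fun S hS => Nat.ceil_le.1 (Pb S hS)) (fun S₁ S₂ h1 h2 h3 => by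
      refine ((Nat.le_floor_iff (by positivity)).1 (Pe S₁ S₂ h1 h2 h3)).trans ?_
      gcongr
      exact Nat.sub_le _ _)
  refine le_trans ?_ ((add_le_add h1 h2).trans_eq (by ring))
  rw [← Nat.cast_add]
  refine Nat.cast_le.2 (le_trans (Finset.card_le_card fun σ hσ => ?_) (Finset.card_union_le _ _))
  rw [Finset.mem_union]
  by_contra hcon
  simp only [Finset.mem_filter, Finset.mem_univ, true_and, not_or, not_not] at hcon hσ
  obtain ⟨⟨c1, c2⟩, c3, c4⟩ := hcon
  have hlink : ∀ i, ((linkBlock a s i).image σ).card = 2 * a := fun i => by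
    rw [Finset.card_image_of_injective _ σ.injective, card_linkBlock hs]
  have hbody : ∀ j, ((bodyBlock a j).image σ).card = b := fun j => by
    rw [Finset.card_image_of_injective _ σ.injective, card_bodyBlock]
  have m1 : ∀ i j, (bodyBlock a j).image σ ∈ nbhd (2 * a + b) E ((linkBlock a s i).image σ) ↔
      blockEdge a s σ i j ∈ E := fun i j => by
    rw [mem_nbhd_of_card (by rw [hlink, hbody]), ← Finset.image_union]; rfl
  have m2 : ∀ i j, (linkBlock a s i).image σ ∈ nbhd (2 * a + b) E ((bodyBlock a j).image σ) ↔
      blockEdge a s σ i j ∈ E := fun i j => by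
    rw [mem_nbhd_of_card (by rw [hlink, hbody, add_comm]), Finset.union_comm,
      ← Finset.image_union]; rfl
  refine hσ ⟨fun i => ?_, fun j => ?_, fun i i' hi => ?_, fun j j' hj => ?_⟩
  · have := c1 _ (hlink i)
    simpa only [blockCount, m1] using this
  · have := c3 _ (hbody j)
    simpa only [blockCount, m2] using this
  · have := c2 _ _ (hlink i) (hlink i') (by
      rw [← Finset.image_inter _ _ σ.injective, Finset.card_image_of_injective _ σ.injective]
      exact card_linkBlock_inter hs hs' hi)
    simpa only [blockCount, m1, Finset.mem_inter] using this
  · have := c4 _ _ (hbody j) (hbody j') (by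
      rw [← Finset.image_inter _ _ σ.injective,
        Finset.disjoint_iff_inter_eq_empty.1 (disjoint_bodyBlock hj), Finset.image_empty])
    simpa only [blockCount, m2, Finset.mem_inter] using this

/-! ### Perfect matchings give Hamilton cycles. -/

theorem val_finRotate {ν : ℕ} (i : Fin ν) :
    (finRotate ν i : ℕ) = if (i : ℕ) + 1 = ν then 0 else (i : ℕ) + 1 := by
  cases ν with
  | zero => exact i.elim0
  | succ m =>
    rw [coe_finRotate]
    simp [Fin.ext_iff]

theorem finRotate_ne_self {ν : ℕ} (hν : 3 ≤ ν) (i : Fin ν) : finRotate ν i ≠ i := fun h => by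
  have := congrArg Fin.val h
  rw [val_finRotate] at this
  split_ifs at this <;> omega

theorem finRotate_finRotate_ne_self {ν : ℕ} (hν : 3 ≤ ν) (i : Fin ν) :
    finRotate ν (finRotate ν i) ≠ i := fun h => by
  have := congrArg Fin.val h
  rw [val_finRotate, val_finRotate] at this
  have := i.2
  split_ifs at * <;> omega

theorem val_finEquiv_symm_natCast (n m : ℕ) [NeZero n] :
    ((ZMod.finEquiv n).symm (m : ZMod n) : ℕ) = m % n := by
  rw [← ZMod.val_natCast]
  cases n with
  | zero => exact absurd rfl (NeZero.ne 0)
  | succ n => rfl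

/-- Permute the bodies of the intervals by `π`, keeping their heads. -/
def bodyPerm (a : ℕ) {ν ℓ : ℕ} (π : Perm (Fin ν)) : Perm (Fin ν × Fin ℓ) where
  toFun q := (if (q.2 : ℕ) < a then q.1 else π q.1, q.2)
  invFun q := (if (q.2 : ℕ) < a then q.1 else π.symm q.1, q.2)
  left_inv q := by ext1 <;> dsimp only; split_ifs <;> simp
  right_inv q := by ext1 <;> dsimp only; split_ifs <;> simp

/-- The cyclic order with heads as in `σ` and bodies rearranged by `π`. -/
def cyclicOrder (a : ℕ) {ν ℓ : ℕ} [NeZero (ν * ℓ)] (σ : Perm (Fin (ν * ℓ))) (π : Perm (Fin ν)) :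
    ZMod (ν * ℓ) ≃ Fin (ν * ℓ) :=
  (ZMod.finEquiv (ν * ℓ)).symm.toEquiv.trans
    ((finProdFinEquiv.symm.trans ((bodyPerm a π).trans finProdFinEquiv)).trans σ)

theorem cyclicOrder_natCast (a : ℕ) {ν ℓ : ℕ} [NeZero (ν * ℓ)] (σ : Perm (Fin (ν * ℓ)))
    (π : Perm (Fin ν)) (i : Fin ν) (r : Fin ℓ) :
    cyclicOrder a σ π (((i : ℕ) * ℓ + r : ℕ) : ZMod (ν * ℓ)) =
      σ (finProdFinEquiv (if (r : ℕ) < a then i else π i, r)) := by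
  have h : (ZMod.finEquiv (ν * ℓ)).symm (((i : ℕ) * ℓ + r : ℕ) : ZMod (ν * ℓ)) =
      finProdFinEquiv (i, r) := by
    apply Fin.ext
    rw [val_finEquiv_symm_natCast]
    have hlt := (finProdFinEquiv (i, r)).2
    have hval : (finProdFinEquiv (i, r) : ℕ) = (i : ℕ) * ℓ + r := by
      rw [finProdFinEquiv_apply_val, mul_comm, add_comm]
    rw [← hval, Nat.mod_eq_of_lt hlt]
  have h2 : cyclicOrder a σ π (((i : ℕ) * ℓ + r : ℕ) : ZMod (ν * ℓ)) =
      σ (finProdFinEquiv (bodyPerm a π (finProdFinEquiv.symm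
        ((ZMod.finEquiv (ν * ℓ)).symm (((i : ℕ) * ℓ + r : ℕ) : ZMod (ν * ℓ)))))) := rfl
  rw [h2, h, Equiv.symm_apply_apply]
  rfl

theorem natCast_finRotate_mul {ν ℓ : ℕ} (i : Fin ν) :
    (((finRotate ν i : ℕ) * ℓ : ℕ) : ZMod (ν * ℓ)) = ((((i : ℕ) + 1) * ℓ : ℕ) : ZMod (ν * ℓ)) := by
  rw [val_finRotate]
  split_ifs with h
  · rw [h, ZMod.natCast_self]; simp
  · rfl

/-- The k = 2a + b positions from iℓ on are head i, the slot now holding body π(i), and head i+1,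
with wrap-around absorbed by `ZMod`. Since the arc has at most k elements, one inclusion is enough.
-/
theorem arc_cyclicOrder {a b ν : ℕ} (hν : 3 ≤ ν) [NeZero (ν * (a + b))]
    (σ : Perm (Fin (ν * (a + b)))) (π : Perm (Fin ν)) (i : Fin ν) :
    arc (cyclicOrder a σ π) (2 * a + b) (((i : ℕ) * (a + b) : ℕ) : ZMod (ν * (a + b))) =
      blockEdge a (finRotate ν) σ i (π i) := by
  symm
  refine Finset.eq_of_subset_of_card_le (fun y hy => ?_) ?_
  · obtain ⟨x, hx, rfl⟩ := Finset.mem_image.1 hy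
    have hmod := x.modNat.2
    have hxx : finProdFinEquiv (x.divNat, x.modNat) = x := finProdFinEquiv.apply_symm_apply x
    refine Finset.mem_image.2 ?_
    rcases Finset.mem_union.1 hx with hx | hx
    · rcases Finset.mem_union.1 hx with hx | hx
      · obtain ⟨h1, h2⟩ := mem_headBlock.1 hx
        refine ⟨x.modNat, Finset.mem_range.2 (by omega), ?_⟩
        rw [← Nat.cast_add, cyclicOrder_natCast, if_pos h2, ← h1, hxx]
      · obtain ⟨h1, h2⟩ := mem_headBlock.1 hx
        refine ⟨a + b + x.modNat, Finset.mem_range.2 (by omega), ?_⟩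
        have : (((i : ℕ) * (a + b) : ℕ) : ZMod (ν * (a + b))) + ((a + b + x.modNat : ℕ) :
            ZMod (ν * (a + b))) = (((finRotate ν i : ℕ) * (a + b) + x.modNat : ℕ) :
            ZMod (ν * (a + b))) := by
          rw [Nat.cast_add ((finRotate ν i : ℕ) * (a + b)), natCast_finRotate_mul]
          push_cast
          ring
        rw [this, cyclicOrder_natCast, if_pos h2, ← h1, hxx]
    · obtain ⟨h1, h2⟩ := mem_bodyBlock.1 hx
      refine ⟨x.modNat, Finset.mem_range.2 (by omega), ?_⟩
      rw [← Nat.cast_add, cyclicOrder_natCast, if_neg h2.not_gt, ← h1, hxx]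
  · rw [card_blockEdge (finRotate_ne_self hν)]
    exact Finset.card_image_le.trans (Finset.card_range _).le

/-- Consecutive edges share only the head between them, of size `a`, and k - a = ℓ. The absence of
fixed points and 2-cycles keeps the three heads involved distinct. -/
theorem card_blockEdge_sdiff {a b ν : ℕ} {s : Perm (Fin ν)} (hs : ∀ i, s i ≠ i)
    (hs' : ∀ i, s (s i) ≠ i) (σ : Perm (Fin (ν * (a + b)))) (π : Perm (Fin ν)) (i : Fin ν) :
    (blockEdge a s σ i (π i) \ blockEdge a s σ (s i) (π (s i))).card = a + b := by
  have h : (blockEdge a s σ i (π i) ∩ blockEdge a s σ (s i) (π (s i))).card = a := by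
    rw [blockEdge, blockEdge, ← Finset.image_inter _ _ σ.injective,
      Finset.card_image_of_injective _ σ.injective]
    refine Eq.trans (congrArg Finset.card ?_) (card_headBlock (b := b) (s i))
    ext x
    have h1 := hs i
    have h2 := hs' i
    have h3 := hs (s i)
    have h4 := π.injective.ne h1
    simp only [linkBlock, Finset.mem_inter, Finset.mem_union, mem_headBlock, mem_bodyBlock]
    grind
  have h1 := Finset.card_sdiff_add_card_inter (blockEdge a s σ i (π i))
    (blockEdge a s σ (s i) (π (s i)))
  rw [h, card_blockEdge hs] at h1
  omega

theorem isHamiltonCycle_of_perm {a b ν : ℕ} (ha : 0 < a) (hb : 0 < b) (hν : 3 ≤ ν)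
    (E : Finset (Finset (Fin (ν * (a + b))))) (σ : Perm (Fin (ν * (a + b)))) (π : Perm (Fin ν))
    (h : ∀ i, blockEdge a (finRotate ν) σ i (π i) ∈ E) :
    IsHamiltonCycle (2 * a + b) (a + b) E
      (Finset.univ.image (fun i => blockEdge a (finRotate ν) σ i (π i))) := by
  have hdiv : ν * (a + b) / (a + b) = ν := Nat.mul_div_cancel ν (by omega)
  have : NeZero (ν * (a + b)) := ⟨(Nat.mul_pos (by omega) (by omega)).ne'⟩
  refine ⟨fun S hS => ?_, ?_, cyclicOrder a σ π, ?_, fun i hi => ?_⟩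
  · obtain ⟨i, -, rfl⟩ := Finset.mem_image.1 hS
    exact h i
  · rw [hdiv, Finset.card_image_of_injective, Finset.card_univ, Fintype.card_fin]
    exact fun i j hij => (blockEdge_injective ha hb (finRotate_finRotate_ne_self hν) σ _ _ _ _ hij).1
  · rw [hdiv]
    ext S
    simp only [Finset.mem_image, Finset.mem_univ, true_and, Finset.mem_range]
    constructor
    · rintro ⟨i, rfl⟩
      exact ⟨i, i.2, arc_cyclicOrder hν σ π i⟩
    · rintro ⟨i, hi, rfl⟩
      exact ⟨⟨i, hi⟩, (arc_cyclicOrder hν σ π ⟨i, hi⟩).symm⟩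
  · rw [hdiv] at hi
    have h1 := arc_cyclicOrder hν σ π ⟨i, hi⟩
    have h2 := arc_cyclicOrder hν σ π (finRotate ν ⟨i, hi⟩)
    rw [natCast_finRotate_mul] at h2
    change arc (cyclicOrder a σ π) (2 * a + b) ((i * (a + b) : ℕ) : ZMod (ν * (a + b))) = _ at h1
    change arc (cyclicOrder a σ π) (2 * a + b) (((i + 1) * (a + b) : ℕ) : ZMod (ν * (a + b))) = _
      at h2
    rw [h1, h2]
    exact card_blockEdge_sdiff (finRotate_ne_self hν) (finRotate_finRotate_ne_self hν) σ π _

/-! ### Many regular orderings and the packing. -/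

theorem exists_injOn_fin {β : Type*} [DecidableEq β] {K : ℕ} (hK : 0 < K) (T : Finset β)
    (hT : T.card ≤ K) :
    ∃ f : β → Fin K, Set.InjOn f T := by
  refine ⟨fun x => if h : x ∈ T then Fin.castLE hT (T.equivFin ⟨x, h⟩) else ⟨0, hK⟩,
    fun x hx y hy h => ?_⟩
  have hx' : x ∈ T := hx
  have hy' : y ∈ T := hy
  simp only [dif_pos hx', dif_pos hy'] at h
  exact congrArg Subtype.val (T.equivFin.injective (Fin.castLE_injective hT h))

/-- The ν² candidate edges of a single ordering are distinct k-sets. -/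
theorem sq_le_choose {a b ν : ℕ} (ha : 0 < a) (hb : 0 < b) (hν : 3 ≤ ν) :
    ν ^ 2 ≤ (ν * (a + b)).choose (2 * a + b) := by
  have h := Finset.card_le_card_of_injOn (s := (Finset.univ : Finset (Fin ν × Fin ν)))
    (t := Finset.powersetCard (2 * a + b) (Finset.univ : Finset (Fin (ν * (a + b)))))
    (fun q => blockEdge a (finRotate ν) 1 q.1 q.2)
    (fun q _ => Finset.mem_coe.2 (Finset.mem_powersetCard.2
      ⟨Finset.subset_univ _, card_blockEdge (finRotate_ne_self hν) _ _ _⟩))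
    (fun q _ q' _ h => Prod.ext_iff.2
      (blockEdge_injective ha hb (finRotate_finRotate_ne_self hν) _ _ _ _ _ h))
  simpa [sq, Finset.card_powersetCard] using h

/-- A union bound over the ν² index pairs, each of which yields a uniformly random k-set. -/
theorem card_exists_blockEdge_eq_le {a b ν : ℕ} {s : Perm (Fin ν)} (hs : ∀ i, s i ≠ i)
    (hk : 2 * a + b ≤ ν * (a + b)) (S : Finset (Fin (ν * (a + b)))) (hS : S.card = 2 * a + b) :
    ((Finset.univ.filter (fun σ => ∃ i j, blockEdge a s σ i j = S)).card : ℝ) ≤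
      (ν : ℝ) ^ 2 / (ν * (a + b)).choose (2 * a + b) * (ν * (a + b)).factorial := by
  have hch : (0 : ℝ) < (ν * (a + b)).choose (2 * a + b) := by exact_mod_cast Nat.choose_pos hk
  have hcard : ∀ i j, (linkBlock a s i ∪ bodyBlock a j : Finset (Fin (ν * (a + b)))).card =
      2 * a + b := fun i j => by
    rw [Finset.card_union_of_disjoint (disjoint_linkBlock_bodyBlock _ _ _), card_linkBlock hs,
      card_bodyBlock]
  have h1 : ∀ q : Fin ν × Fin ν, ((Finset.univ.filter
      (fun σ : Perm (Fin (ν * (a + b))) => blockEdge a s σ q.1 q.2 = S)).card : ℝ) =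
      (ν * (a + b)).factorial / (ν * (a + b)).choose (2 * a + b) := fun q => by
    rw [eq_div_iff hch.ne']
    have := card_perm_image_eq (linkBlock a s q.1 ∪ bodyBlock a q.2) S (by rw [hS, hcard])
    rw [hcard] at this
    exact_mod_cast this
  have h2 : Finset.univ.filter (fun σ => ∃ i j, blockEdge a s σ i j = S) ⊆
      (Finset.univ : Finset (Fin ν × Fin ν)).biUnion fun q => Finset.univ.filter
        (fun σ : Perm (Fin (ν * (a + b))) => blockEdge a s σ q.1 q.2 = S) := fun σ hσ => by
    obtain ⟨i, j, h⟩ := (Finset.mem_filter.1 hσ).2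
    exact Finset.mem_biUnion.2 ⟨(i, j), Finset.mem_univ _,
      Finset.mem_filter.2 ⟨Finset.mem_univ _, h⟩⟩
  refine (Nat.cast_le.2 ((Finset.card_le_card h2).trans Finset.card_biUnion_le)).trans ?_
  push_cast
  rw [Finset.sum_congr rfl fun q _ => h1 q]
  simp only [Finset.sum_const, Finset.card_univ, Fintype.card_prod, Fintype.card_fin, nsmul_eq_mul]
  push_cast
  exact le_of_eq (by ring)

/-- There are many regular orderings that jointly produce every candidate edge at most `K` times. -/
theorem exists_regular_orders {a b ν : ℕ} (ha : 0 < a) (hb : 0 < b) (hν : 3 ≤ ν)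
    (hk : 2 * a + b ≤ ν * (a + b))
    (E : Finset (Finset (Fin (ν * (a + b)))))
    (hE : (E : Set (Finset (Fin (ν * (a + b))))).Sized (2 * a + b))
    {ε : ℝ} (hε : 0 < ε) (hε' : ε ≤ 1 / 8)
    (hnε : (2 * a * b : ℝ) ≤ ε / 32 * (ν * (a + b) : ℕ))
    (hP : PseudoRandom (2 * a + b) (a + b) ε E)
    (hbad : 4 * ((ν * (a + b) : ℕ) : ℝ) ^ (2 * (2 * a + b)) *
      Real.exp (-((ν * density (2 * a + b) E ^ 2 * (ε / 32)) ^ 2 / (128 * (ν * (a + b) : ℕ))))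
        ≤ ε / 16)
    (N K : ℕ)
    (hN : (N : ℝ) * ν ^ 2 * (1 + ε) ≤ K * (1 - ε / 16) * (ν * (a + b)).choose (2 * a + b))
    (hK : ((ν * (a + b) : ℕ) : ℝ) ^ (2 * a + b) * Real.exp (-(K * ε ^ 2 / 8)) < 1) :
    ∃ σ : Fin N → Perm (Fin (ν * (a + b))),
      (∀ t, IsRegularOrder a (finRotate ν) E ε (density (2 * a + b) E) (σ t)) ∧
      ∀ S : Finset (Fin (ν * (a + b))), S.card = 2 * a + b →
        (Finset.univ.filter (fun t => ∃ i j, blockEdge a (finRotate ν) (σ t) i j = S)).card ≤ K := by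
  classical
  set G := Finset.univ.filter
    (fun σ => IsRegularOrder a (finRotate ν) E ε (density (2 * a + b) E) σ) with hG
  have hs := finRotate_ne_self hν
  have hfac : (0 : ℝ) < (ν * (a + b)).factorial := by exact_mod_cast Nat.factorial_pos _
  have hch : (0 : ℝ) < (ν * (a + b)).choose (2 * a + b) := by exact_mod_cast Nat.choose_pos hk
  have hGcard : (1 - ε / 16) * (ν * (a + b)).factorial ≤ (G.card : ℝ) := by
    have h1 := card_not_isRegularOrder_le ha hb hk hs (finRotate_finRotate_ne_self hν) E hE hε hε'
      hnε hP
    have h2 : (G.card : ℝ) + ((Finset.univ.filter (fun σ => ¬ IsRegularOrder a (finRotate ν) E ε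
        (density (2 * a + b) E) σ)).card : ℝ) = (ν * (a + b)).factorial := by
      have := Finset.card_filter_add_card_filter_not (s := Finset.univ)
        (fun σ => IsRegularOrder a (finRotate ν) E ε (density (2 * a + b) E) σ)
      rw [Finset.card_univ, Fintype.card_perm, Fintype.card_fin] at this
      rw [hG]
      exact_mod_cast this
    have h3 := mul_le_mul_of_nonneg_right hbad hfac.le
    nlinarith
  have hG0 : (0 : ℝ) < G.card := lt_of_lt_of_le (mul_pos (by linarith) hfac) hGcard
  have hε16 : 0 < 1 - ε / 16 := by linarith
  -- The division by 1 - ε/16 pays for sampling only among regular orderings. With l = ε/2 the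
  -- exponent is at most -Kε²/8, which beats the number of k-sets by `hK`.
  obtain ⟨σ, h1, h2⟩ := exists_tuple_card_le
    (ι := Finset.powersetCard (2 * a + b) (Finset.univ : Finset (Fin (ν * (a + b))))) G
    (Finset.card_pos.1 (by exact_mod_cast hG0))
    (fun S σ => ∃ i j, blockEdge a (finRotate ν) σ i j = S.1) N K
    ((ν : ℝ) ^ 2 / (ν * (a + b)).choose (2 * a + b) / (1 - ε / 16)) (ε / 2) (by positivity)
    (fun S => by
      have e1 := card_exists_blockEdge_eq_le hs hk S.1 (Finset.mem_powersetCard.1 S.2).2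
      refine le_trans (Nat.cast_le.2 (Finset.card_le_card
        (Finset.filter_subset_filter _ (Finset.subset_univ _)))) (e1.trans ?_)
      rw [div_mul_eq_mul_div _ (1 - ε / 16), le_div_iff₀ hε16, mul_assoc, mul_comm _ (1 - ε / 16)]
      gcongr)
    (by
      refine lt_of_le_of_lt ?_ hK
      have e1 : Fintype.card (Finset.powersetCard (2 * a + b)
          (Finset.univ : Finset (Fin (ν * (a + b))))) ≤ (ν * (a + b)) ^ (2 * a + b) := by
        rw [Fintype.card_coe, Finset.card_powersetCard, Finset.card_univ, Fintype.card_fin]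
        exact Nat.choose_le_pow _ _
      have e2 : (Fintype.card (Finset.powersetCard (2 * a + b)
          (Finset.univ : Finset (Fin (ν * (a + b))))) : ℝ) ≤
          ((ν * (a + b) : ℕ) : ℝ) ^ (2 * a + b) := by exact_mod_cast e1
      refine mul_le_mul e2 (Real.exp_le_exp.2 ?_) (Real.exp_pos _).le (by positivity)
      have e3 : Real.exp (ε / 2) - 1 ≤ ε / 2 + (ε / 2) ^ 2 := by
        have := Real.abs_exp_sub_one_sub_id_le (x := ε / 2)
          (by rw [abs_of_pos (by positivity)]; linarith)
        have := (abs_le.1 this).2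
        linarith
      set q : ℝ := (N : ℝ) * ((ν : ℝ) ^ 2 / (ν * (a + b)).choose (2 * a + b) / (1 - ε / 16)) with hq
      have e4 : q * (1 + ε) ≤ K := by
        have : q * (1 + ε) = (N : ℝ) * ν ^ 2 * (1 + ε) /
            ((1 - ε / 16) * (ν * (a + b)).choose (2 * a + b)) := by
          rw [hq]; field_simp
        rw [this, div_le_iff₀ (mul_pos hε16 hch)]
        linarith
      have hq0 : 0 ≤ q := by positivity
      rw [← mul_assoc, ← hq]
      have e5 : q * (Real.exp (ε / 2) - 1) ≤ q * (ε / 2 + (ε / 2) ^ 2) := by gcongr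
      have e6 : q * (1 + ε / 2) ≤ K * (1 - ε / 4) := by
        have : q * (1 + ε / 2) ≤ q * ((1 + ε) * (1 - ε / 4)) := by
          gcongr
          nlinarith
        nlinarith
      nlinarith)
  refine ⟨σ, fun t => (Finset.mem_filter.1 (h1 t)).2, fun S hS => ?_⟩
  exact h2 ⟨S, Finset.mem_powersetCard.2 ⟨Finset.subset_univ _, hS⟩⟩

/-- The thinning loss ε/32 turns the 17ε/16 of a regular ordering into at most 9ε/8; the next lemma
is the matching upper bound. -/
theorem one_sub_mul_le_thinned {ε y : ℝ} (hε : 0 ≤ ε) (hy : 0 ≤ y) :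
    (1 - 9 / 8 * ε) * y ≤ (1 - ε / 32) * ((1 - 17 / 16 * ε) * y) := by
  nlinarith [mul_nonneg hy hε, mul_nonneg hy (sq_nonneg ε)]

theorem thinned_le_one_add_mul {ε y : ℝ} (hε : 0 ≤ ε) (hε' : ε ≤ 1 / 8) (hy : 0 ≤ y) :
    (1 + ε / 32) * ((1 + 17 / 16 * ε) * y) ≤ (1 + 9 / 8 * ε) * y := by
  nlinarith [mul_nonneg hy hε, mul_nonneg hy (mul_nonneg hε (sub_nonneg.2 hε'))]

set_option maxHeartbeats 800000 in
/-- The packing, under explicit numerical conditions on the number `N` of orderings and the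
multiplicity `K` with which they cover the edges. -/
theorem exists_hamilton_packing {a b ν : ℕ} (ha : 0 < a) (hb : 0 < b) (hν : 3 ≤ ν)
    (hk : 2 * a + b ≤ ν * (a + b))
    (E : Finset (Finset (Fin (ν * (a + b)))))
    (hE : (E : Set (Finset (Fin (ν * (a + b))))).Sized (2 * a + b))
    {ε p : ℝ} (hp : p = density (2 * a + b) E) (hε : 0 < ε) (hε' : ε ≤ 1 / 8)
    (hnε : (2 * a * b : ℝ) ≤ ε / 32 * (ν * (a + b) : ℕ))
    (hP : PseudoRandom (2 * a + b) (a + b) ε E)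
    (hbad : 4 * ((ν * (a + b) : ℕ) : ℝ) ^ (2 * (2 * a + b)) *
      Real.exp (-((ν * p ^ 2 * (ε / 32)) ^ 2 / (128 * (ν * (a + b) : ℕ)))) ≤ ε / 16)
    (N K : ℕ) (hK0 : 0 < K)
    (hN : (N : ℝ) * ν ^ 2 * (1 + ε) ≤ K * (1 - ε / 16) * (ν * (a + b)).choose (2 * a + b))
    (hK : ((ν * (a + b) : ℕ) : ℝ) ^ (2 * a + b) * Real.exp (-(K * ε ^ 2 / 8)) < 1)
    (hM : 16 ≤ ν * p / K * ε ^ 2)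
    (hthin : 2 * N * (ν : ℝ) ^ 2 * Real.exp (-((ε / 32) ^ 2 * (ν * p ^ 2 / (2 * K ^ 2)) / 4)) < 1) :
    ∃ 𝒞 : Finset (Finset (Finset (Fin (ν * (a + b))))),
      (∀ C ∈ 𝒞, IsHamiltonCycle (2 * a + b) (a + b) E C) ∧
      (∀ C ∈ 𝒞, ∀ C' ∈ 𝒞, C ≠ C' → Disjoint C C') ∧
      𝒞.card = N * ⌊(1 - 4 * ε) * (ν * p / K)⌋₊ := by
  classical
  have hs := finRotate_ne_self hν
  have hs' := finRotate_finRotate_ne_self hν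
  have hp0 : 0 ≤ p := hp ▸ density_nonneg _ _
  have hp1 : p ≤ 1 := hp ▸ density_le_one hE
  subst hp
  set p := density (2 * a + b) E with hp
  have hK1 : (1 : ℝ) ≤ K := by exact_mod_cast hK0
  have hKpos : (0 : ℝ) < K := by linarith
  have hνpos : (0 : ℝ) < ν := by exact_mod_cast (by omega : 0 < ν)
  obtain ⟨σ, hσ, hmult⟩ := exists_regular_orders ha hb hν hk E hE hε hε' hnε hP hbad N K hN hK
  -- Each k-set gives distinct colours to the orderings in which it is a candidate; `K` colours
  -- suffice by the multiplicity bound.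
  have hc : ∀ S : Finset (Fin (ν * (a + b))), ∃ f : Fin N → Fin K, S.card = 2 * a + b →
      Set.InjOn f {t | ∃ i j, blockEdge a (finRotate ν) (σ t) i j = S} := fun S => by
    by_cases hS : S.card = 2 * a + b
    · obtain ⟨f, hf⟩ := exists_injOn_fin hK0 _ (hmult S hS)
      exact ⟨f, fun _ => by simpa using hf⟩
    · exact ⟨fun _ => ⟨0, hK0⟩, fun h => absurd h hS⟩
  choose c hcinj using hc
  have hνp : 0 ≤ ν * p := by positivity
  have hνp2 : 0 ≤ ν * p ^ 2 := by positivity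
  -- The Boolean selects a bipartite graph or its transpose, so that degrees and codegrees on both
  -- sides are controlled by one colouring.
  obtain ⟨ω, hω⟩ := exists_thinning (ι := Fin N × Bool) (γ := Fin ν) hK0 E
    (fun τ i j => if τ.2 then blockEdge a (finRotate ν) (σ τ.1) j i
      else blockEdge a (finRotate ν) (σ τ.1) i j)
    (fun τ i j i' j' h => by
      split_ifs at h
      · exact (blockEdge_injective ha hb hs' _ _ _ _ _ h).symm
      · exact blockEdge_injective ha hb hs' _ _ _ _ _ h)
    (fun τ S => c S τ.1) ((1 - 17 / 16 * ε) * (ν * p)) ((1 + 17 / 16 * ε) * (ν * p ^ 2))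
    (ε / 32) (ν * p ^ 2 / (2 * K ^ 2)) (by positivity) (by linarith)
    (fun τ i => by
      obtain ⟨t, _ | _⟩ := τ
      · simpa using (hσ t).deg_link i
      · simpa using (hσ t).deg_body i)
    (fun τ i i' hi => by
      obtain ⟨t, _ | _⟩ := τ
      · simpa using (hσ t).codeg_link i i' hi
      · simpa using (hσ t).codeg_body i i' hi)
    (by
      rw [div_le_div_iff₀ (by positivity) hKpos]
      have e1 : ν * p ^ 2 ≤ ν * p := by gcongr; nlinarith
      have e2 : ν * p ≤ (1 - 17 / 16 * ε) * (ν * p) * 2 := by nlinarith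
      calc ν * p ^ 2 * K ≤ ((1 - 17 / 16 * ε) * (ν * p) * 2) * K :=
            mul_le_mul_of_nonneg_right (e1.trans e2) hKpos.le
        _ ≤ ((1 - 17 / 16 * ε) * (ν * p) * 2) * (K * K) :=
            mul_le_mul_of_nonneg_left (by nlinarith) (hνp.trans e2)
        _ = _ := by ring)
    (by
      rw [div_le_div_iff₀ (by positivity) (by positivity)]
      have : 0 ≤ (ν * p ^ 2) * (K : ℝ) ^ 2 := by positivity
      nlinarith)
    (by positivity)
    (by
      refine lt_of_le_of_lt (le_of_eq ?_) hthin
      simp only [Fintype.card_prod, Fintype.card_fin, Fintype.card_bool]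
      push_cast
      ring)
  set Γ : Fin N → Finset (Fin ν × Fin ν) := fun t => Finset.univ.filter (fun q =>
    blockEdge a (finRotate ν) (σ t) q.1 q.2 ∈ E ∧
      ω (blockEdge a (finRotate ν) (σ t) q.1 q.2) = c (blockEdge a (finRotate ν) (σ t) q.1 q.2) t)
    with hΓ
  have hmemΓ : ∀ t i j, (i, j) ∈ Γ t ↔ blockEdge a (finRotate ν) (σ t) i j ∈ E ∧
      ω (blockEdge a (finRotate ν) (σ t) i j) = c (blockEdge a (finRotate ν) (σ t) i j) t :=
    fun t i j => by simp [hΓ]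
  have hlow : (1 - 9 / 8 * ε) * (ν * p / K) ≤
      (1 - ε / 32) * ((1 - 17 / 16 * ε) * (ν * p) / K) := by
    rw [mul_div_assoc (1 - 17 / 16 * ε)]
    exact one_sub_mul_le_thinned hε.le (by positivity)
  have hup : (1 + ε / 32) * ((1 + 17 / 16 * ε) * (ν * p ^ 2) / K ^ 2) ≤
      (1 + 9 / 8 * ε) * (ν * p / K) ^ 2 / Fintype.card (Fin ν) := by
    have e1 : (1 + 9 / 8 * ε) * (ν * p / K) ^ 2 / Fintype.card (Fin ν) =
        (1 + 9 / 8 * ε) * (ν * p ^ 2 / K ^ 2) := by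
      rw [Fintype.card_fin]; field_simp
    rw [e1, mul_div_assoc (1 + 17 / 16 * ε)]
    exact thinned_le_one_add_mul hε.le hε' (by positivity)
  set r := ⌊(1 - 4 * ε) * (ν * p / K)⌋₊ with hr
  have hpack : ∀ t, ∃ π : Fin r → Perm (Fin ν), (∀ u x, (x, π u x) ∈ Γ t) ∧
      ∀ u u', u ≠ u' → ∀ x, π u x ≠ π u' x := fun t => by
    have hf := hω (t, false)
    have ht := hω (t, true)
    simp only [Bool.false_eq_true, if_false, if_true, ← hmemΓ] at hf ht
    exact exists_disjoint_perms_of_codegree_le (Γ t) hε hε' hM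
      (fun x => hlow.trans (hf.1 x)) (fun y => hlow.trans (ht.1 y))
      (fun x x' hx => (hf.2 x x' hx).trans hup) (fun y y' hy => (ht.2 y y' hy).trans hup) r
      (Nat.floor_le (mul_nonneg (by linarith) (by positivity)))
  choose π hπ hπd using hpack
  set cyc : Fin N × Fin r → Finset (Finset (Fin (ν * (a + b)))) := fun q =>
    Finset.univ.image (fun i => blockEdge a (finRotate ν) (σ q.1) i (π q.1 q.2 i)) with hcyc
  have hdisj : ∀ q q', q ≠ q' → Disjoint (cyc q) (cyc q') := by
    rintro ⟨t, u⟩ ⟨t', u'⟩ hne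
    refine Finset.disjoint_left.2 fun S hS hS' => hne ?_
    obtain ⟨i, -, hi⟩ := Finset.mem_image.1 hS
    obtain ⟨i', -, hi'⟩ := Finset.mem_image.1 hS'
    dsimp only at hi hi'
    have h1 := ((hmemΓ t i _).1 (hπ t u i)).2
    have h2 := ((hmemΓ t' i' _).1 (hπ t' u' i')).2
    rw [hi] at h1
    rw [hi'] at h2
    have hcard : S.card = 2 * a + b := by rw [← hi, card_blockEdge hs]
    -- An edge shared by two cycles has a single colour, and that colour identifies the ordering.
    -- Within one ordering the matchings are already disjoint.
    have ht : t = t' := hcinj S hcard ⟨_, _, hi⟩ ⟨_, _, hi'⟩ (h1.symm.trans h2)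
    subst ht
    obtain ⟨rfl, h3⟩ := blockEdge_injective ha hb hs' _ _ _ _ _ (hi.trans hi'.symm)
    by_cases hu : u = u'
    · rw [hu]
    · exact absurd h3 (hπd t u u' hu i)
  have hne : ∀ q, (cyc q).Nonempty := fun q =>
    ⟨_, Finset.mem_image_of_mem _ (Finset.mem_univ (⟨0, by omega⟩ : Fin ν))⟩
  have hinj : Function.Injective cyc := fun q q' h => by
    by_contra hqq
    have := hdisj q q' hqq
    rw [h, disjoint_self] at this
    exact (hne q').ne_empty this
  refine ⟨Finset.univ.image cyc, fun C hC => ?_, fun C hC C' hC' hCC => ?_, ?_⟩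
  · obtain ⟨q, -, rfl⟩ := Finset.mem_image.1 hC
    exact isHamiltonCycle_of_perm ha hb hν E (σ q.1) (π q.1 q.2) fun i =>
      ((hmemΓ q.1 i _).1 (hπ q.1 q.2 i)).1
  · obtain ⟨q, -, rfl⟩ := Finset.mem_image.1 hC
    obtain ⟨q', -, rfl⟩ := Finset.mem_image.1 hC'
    exact hdisj q q' fun h => hCC (by rw [h])
  · rw [Finset.card_image_of_injective _ hinj]
    simp

/-! ### Choice of the numerical parameters. -/

theorem pow_mul_exp_neg_log_mul {x : ℝ} (hx : 0 < x) (j i : ℕ) :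
    x ^ j * Real.exp (-((j + i : ℕ) * Real.log x)) = 1 / x ^ i := by
  rw [Real.exp_neg, ← Real.log_pow, Real.exp_log (by positivity), pow_add]
  field_simp

/-- Every numerical requirement is a weakening of the one inequality A·L⁶ ≤ n·p⁴·ε¹⁰, because L ≥ 1
and p, ε ≤ 1. -/
theorem le_mul_pow_mul_pow_of_le {n A L p ε : ℝ} (hn : 0 ≤ n) (hA0 : 0 ≤ A) (hL : 1 ≤ L)
    (hp0 : 0 ≤ p) (hp1 : p ≤ 1) (hε : 0 ≤ ε) (hε1 : ε ≤ 1) (hA : A * L ^ 6 ≤ n * p ^ 4 * ε ^ 10)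
    (i j m : ℕ) (hi : i ≤ 6) (hj : j ≤ 4) (hm : m ≤ 10) : A * L ^ i ≤ n * p ^ j * ε ^ m :=
  calc A * L ^ i ≤ A * L ^ 6 := by gcongr
    _ ≤ _ := hA
    _ ≤ n * p ^ j * ε ^ m := by
      have h1 : p ^ 4 ≤ p ^ j := pow_le_pow_of_le_one hp0 hp1 hj
      have h2 : ε ^ 10 ≤ ε ^ m := pow_le_pow_of_le_one hε hε1 hm
      gcongr

/-- The exponent equals np⁴ε²/(131072ℓ²), with 131072 = 32²·128. It is at least (2k+2)·log n, so a
factor n⁻² survives the union bound. -/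
theorem failure_probability_le {k n : ℕ} {ν ε p L A ℓ : ℝ} (hn64 : (64 : ℝ) ≤ n)
    (hℓ0 : 0 < ℓ) (hnν : (n : ℝ) = ν * ℓ)
    (hp0 : 0 ≤ p) (hp1 : p ≤ 1) (hε : 0 < ε) (hε1 : ε ≤ 1) (hL : L = Real.log n) (hL1 : 1 ≤ L)
    (hA0 : 1 ≤ A) (hA1 : 131072 * ℓ ^ 2 * (2 * k + 2) ≤ A)
    (hA : A * L ^ 6 ≤ n * p ^ 4 * ε ^ 10) :
    4 * (n : ℝ) ^ (2 * k) *
      Real.exp (-((ν * p ^ 2 * (ε / 32)) ^ 2 / (128 * n))) ≤ ε / 16 := by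
  have hn0 : (0 : ℝ) < n := by linarith
  have hAL := le_mul_pow_mul_pow_of_le hn0.le (by linarith) hL1 hp0 hp1 hε.le hε1 hA
  have hnε : 1 ≤ n * ε := by
    have := hAL 0 0 1 (by norm_num) (by norm_num) (by norm_num)
    simp only [pow_zero, mul_one, pow_one] at this
    linarith
  have h1 : ((2 * k + 2 : ℕ) : ℝ) * L ≤ (ν * p ^ 2 * (ε / 32)) ^ 2 / (128 * n) := by
    have h2 := hAL 1 4 2 (by norm_num) (by norm_num) (by norm_num)
    rw [le_div_iff₀ (by positivity)]
    have h3 : 131072 * ℓ ^ 2 * (2 * k + 2) * L ≤ n * p ^ 4 * ε ^ 2 := by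
      have : 131072 * ℓ ^ 2 * (2 * k + 2) * L ≤ A * L := by gcongr
      rw [pow_one] at h2
      linarith
    push_cast
    have h4 : 131072 * n * ((2 * k + 2) * L) ≤ (ν * p ^ 2 * ε) ^ 2 := by
      refine le_of_mul_le_mul_right ?_ (show 0 < ℓ ^ 2 by positivity)
      calc 131072 * n * ((2 * k + 2) * L) * ℓ ^ 2
          = n * (131072 * ℓ ^ 2 * (2 * k + 2) * L) := by ring
        _ ≤ n * (n * p ^ 4 * ε ^ 2) := by gcongr
        _ = _ := by rw [hnν]; ring
    have h5 : (ν * p ^ 2 * (ε / 32)) ^ 2 = (ν * p ^ 2 * ε) ^ 2 / 1024 := by ring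
    rw [h5]
    linarith
  calc 4 * (n : ℝ) ^ (2 * k) * Real.exp (-((ν * p ^ 2 * (ε / 32)) ^ 2 / (128 * n)))
      ≤ 4 * (n : ℝ) ^ (2 * k) * Real.exp (-((2 * k + 2 : ℕ) * L)) := by gcongr
    _ = 4 * (1 / (n : ℝ) ^ 2) := by
      rw [mul_assoc, hL]; congr 1; exact pow_mul_exp_neg_log_mul hn0 (2 * k) 2
    _ ≤ ε / 16 := by
      rw [mul_one_div, div_le_iff₀ (by positivity)]
      have := mul_le_mul hn64 hnε zero_le_one hn0.le
      linarith

set_option maxHeartbeats 1600000 in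
/-- The number `N` of orderings and the multiplicity `K` used in the packing. -/
theorem exists_packing_parameters {k n ν : ℕ} {ε p L A B ℓ : ℝ}
    (hn64 : (64 : ℝ) ≤ n) (hνpos : (0 : ℝ) < ν) (hℓ0 : 0 < ℓ) (hnν : (n : ℝ) = ν * ℓ)
    (hC : ν ^ 2 ≤ n.choose k)
    (hp0 : 0 ≤ p) (hp1 : p ≤ 1) (hε : 0 < ε) (hε' : ε < 1 / 8) (hL : L = Real.log n) (hL1 : 1 ≤ L)
    (hB : B = 8 * k + 9) (hBn : B ≤ n) (hA0 : 1 ≤ A) (hA2 : 16 * ℓ * B ≤ A)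
    (hA3 : 8192 * ℓ * B ^ 2 * (k + 5) ≤ A)
    (hA : A * L ^ 6 ≤ n * p ^ 4 * ε ^ 10) :
    ∃ N K : ℕ, 0 < K ∧ (N : ℝ) * ν ^ 2 * (1 + ε) ≤ K * (1 - ε / 16) * n.choose k ∧
      (n : ℝ) ^ k * Real.exp (-(K * ε ^ 2 / 8)) < 1 ∧
      16 ≤ ν * p / K * ε ^ 2 ∧
      2 * N * (ν : ℝ) ^ 2 * Real.exp (-((ε / 32) ^ 2 * (ν * p ^ 2 / (2 * K ^ 2)) / 4)) < 1 ∧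
      (1 - 8 * ε) * (p * n.choose k) / ν ≤ N * (⌊(1 - 4 * ε) * (ν * p / K)⌋₊ : ℝ) := by
  have hn0 : (0 : ℝ) < n := by linarith
  have hε1 : ε ≤ 1 := by linarith
  have hB9 : 9 ≤ B := by
    have : (0 : ℝ) ≤ k := Nat.cast_nonneg k
    linarith
  have hAL := le_mul_pow_mul_pow_of_le hn0.le (by linarith) hL1 hp0 hp1 hε.le hε1 hA
  have hnε : A ≤ n * ε := by
    have := hAL 0 0 1 (by norm_num) (by norm_num) (by norm_num)
    simpa only [pow_zero, mul_one, pow_one] using this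
  have hLn : L ≤ n := by
    rw [hL]; have := Real.log_le_sub_one_of_pos hn0; linarith
  -- Large enough that exp(-Kε²/8) ≤ n^(-(k+1)), which beats the n^k sets. The constant B = 8k + 9
  -- absorbs the rounding, since L/ε² ≥ 1.
  set K : ℕ := ⌈8 * (k + 1) * L / ε ^ 2⌉₊ with hK
  have hK_ge : 8 * (k + 1) * L / ε ^ 2 ≤ K := Nat.le_ceil _
  have hLε : 1 ≤ L / ε ^ 2 := by
    rw [le_div_iff₀ (by positivity)]; linarith [pow_le_one₀ hε.le hε1 (n := 2)]
  have hK_le : K ≤ B * L / ε ^ 2 := by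
    have h1 : (K : ℝ) < 8 * (k + 1) * L / ε ^ 2 + 1 := Nat.ceil_lt_add_one (by positivity)
    have h2 : B * L / ε ^ 2 = 8 * (k + 1) * L / ε ^ 2 + L / ε ^ 2 := by rw [hB]; ring
    linarith
  have hK64 : 64 ≤ K * ε := by
    have h1 : 8 * (k + 1) * L / ε ^ 2 * ε ≤ K * ε := by gcongr
    have h2 : 8 * (k + 1) * L / ε ^ 2 * ε = 8 * (k + 1) * L / ε := by field_simp
    rw [h2] at h1
    refine le_trans ?_ h1
    rw [le_div_iff₀ hε]
    have h3 : 1 ≤ (k + 1 : ℝ) * L := one_le_mul_of_one_le_of_one_le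
      (le_add_of_nonneg_left (Nat.cast_nonneg k)) hL1
    linarith
  have hKpos : (0 : ℝ) < K := by
    by_contra h
    have := mul_nonpos_of_nonpos_of_nonneg (not_lt.1 h) hε.le
    linarith
  have hK0 : 0 < K := by exact_mod_cast hKpos
  have hKε2 : (K : ℝ) * ε ^ 2 ≤ B * L := by
    rwa [le_div_iff₀ (by positivity)] at hK_le
  -- With `W` orderings the average multiplicity of a k-set would be `K`. Dividing by 1 + 2ε leaves
  -- room for the factors 1 + ε and 1 - ε/16.
  set W : ℝ := K * n.choose k / (ν : ℝ) ^ 2 with hW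
  have hKW : (K : ℝ) ≤ W := by
    rw [hW, le_div_iff₀ (by positivity)]
    gcongr
    exact_mod_cast hC
  set N : ℕ := ⌊W / (1 + 2 * ε)⌋₊ with hN
  have hN_le : (N : ℝ) ≤ W / (1 + 2 * ε) := Nat.floor_le (by positivity)
  have hN_ge : W / (1 + 2 * ε) - 1 ≤ N := (Nat.sub_one_lt_floor _).le
  set M : ℝ := ν * p / K with hM
  have hMε : 16 ≤ M * ε ^ 2 := by
    have h1 := hAL 1 1 4 (by norm_num) (by norm_num) (by norm_num)
    rw [hM, div_mul_eq_mul_div, le_div_iff₀ hKpos]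
    have h3 : 16 * (ℓ * (B * L)) ≤ ν * p * ε ^ 4 * ℓ := by
      have : 16 * ℓ * B * L ≤ A * L := by gcongr
      rw [pow_one, pow_one, hnν] at h1
      linarith
    have h4 : 16 * (B * L) ≤ ν * p * ε ^ 4 := by
      refine le_of_mul_le_mul_right ?_ hℓ0
      linarith
    have h5 : 16 * K * ε ^ 2 ≤ ν * p * ε ^ 2 * ε ^ 2 := by
      calc 16 * K * ε ^ 2 = 16 * (K * ε ^ 2) := by ring
        _ ≤ 16 * (B * L) := by gcongr
        _ ≤ _ := h4
        _ = _ := by ring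
    exact le_of_mul_le_mul_right h5 (by positivity)
  have hexpK : (n : ℝ) ^ k * Real.exp (-(K * ε ^ 2 / 8)) < 1 := by
    have h1 : ((k + 1 : ℕ) : ℝ) * L ≤ K * ε ^ 2 / 8 := by
      rw [div_le_iff₀ (by positivity)] at hK_ge
      push_cast
      linarith
    calc (n : ℝ) ^ k * Real.exp (-(K * ε ^ 2 / 8))
        ≤ (n : ℝ) ^ k * Real.exp (-((k + 1 : ℕ) * L)) := by gcongr
      _ = 1 / (n : ℝ) ^ 1 := by rw [hL]; exact pow_mul_exp_neg_log_mul hn0 k 1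
      _ < 1 := by rw [pow_one, div_lt_one hn0]; linarith
  have hthin : 2 * N * (ν : ℝ) ^ 2 *
      Real.exp (-((ε / 32) ^ 2 * (ν * p ^ 2 / (2 * K ^ 2)) / 4)) < 1 := by
    have h1 : ((k + 5 : ℕ) : ℝ) * L ≤ (ε / 32) ^ 2 * (ν * p ^ 2 / (2 * K ^ 2)) / 4 := by
      have h2 := hAL 3 2 6 (by norm_num) (by norm_num) (by norm_num)
      have h3 : 8192 * ℓ * B ^ 2 * (k + 5) * L ^ 3 ≤ n * p ^ 2 * ε ^ 6 := by
        have : 8192 * ℓ * B ^ 2 * (k + 5) * L ^ 3 ≤ A * L ^ 3 := by gcongr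
        linarith
      have e1 : (ε / 32) ^ 2 * (ν * p ^ 2 / (2 * K ^ 2)) / 4 =
          ε ^ 2 * (ν * p ^ 2) / (8192 * K ^ 2) := by field_simp; ring
      rw [e1, le_div_iff₀ (by positivity)]
      refine le_of_mul_le_mul_right ?_ (show 0 < ℓ * ε ^ 4 by positivity)
      push_cast
      have h4 : ((K : ℝ) * ε ^ 2) ^ 2 ≤ (B * L) ^ 2 := by gcongr
      calc (k + 5) * L * (8192 * K ^ 2) * (ℓ * ε ^ 4)
          = 8192 * ℓ * (k + 5) * L * ((K : ℝ) * ε ^ 2) ^ 2 := by ring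
        _ ≤ 8192 * ℓ * (k + 5) * L * (B * L) ^ 2 := by gcongr
        _ = 8192 * ℓ * B ^ 2 * (k + 5) * L ^ 3 := by ring
        _ ≤ n * p ^ 2 * ε ^ 6 := h3
        _ = _ := by rw [hnν]; ring
    have hKn : (K : ℝ) ≤ n ^ 4 := by
      refine hK_le.trans ?_
      rw [div_le_iff₀ (by positivity)]
      have h2 : 1 ≤ (n * ε) ^ 2 := by
        have : 1 ≤ n * ε := hA0.trans hnε
        exact one_le_pow₀ this
      calc B * L ≤ n * n := by gcongr
        _ ≤ n * n * (n * ε) ^ 2 := le_mul_of_one_le_right (by positivity) h2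
        _ = _ := by ring
    have hNν : (N : ℝ) * (ν : ℝ) ^ 2 ≤ (n : ℝ) ^ (k + 4) := by
      have h2 : (N : ℝ) ≤ W := hN_le.trans (div_le_self (by positivity) (by linarith))
      have h3 : (n.choose k : ℝ) ≤ (n : ℝ) ^ k := by exact_mod_cast Nat.choose_le_pow n k
      calc (N : ℝ) * (ν : ℝ) ^ 2 ≤ W * (ν : ℝ) ^ 2 := by gcongr
        _ = (K : ℝ) * n.choose k := by rw [hW]; field_simp
        _ ≤ (n : ℝ) ^ 4 * (n : ℝ) ^ k := by gcongr
        _ = _ := by ring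
    calc 2 * N * (ν : ℝ) ^ 2 * Real.exp (-((ε / 32) ^ 2 * (ν * p ^ 2 / (2 * K ^ 2)) / 4))
        = 2 * ((N * (ν : ℝ) ^ 2) *
          Real.exp (-((ε / 32) ^ 2 * (ν * p ^ 2 / (2 * K ^ 2)) / 4))) := by ring
      _ ≤ 2 * ((n : ℝ) ^ (k + 4) * Real.exp (-(((k + 4) + 1 : ℕ) * L))) := by
        gcongr
      _ = 2 * (1 / (n : ℝ) ^ 1) := by
        rw [hL]; congr 1; exact pow_mul_exp_neg_log_mul hn0 (k + 4) 1
      _ < 1 := by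
        rw [mul_one_div, pow_one, div_lt_one hn0]; linarith
  have hNK : (N : ℝ) * ν ^ 2 * (1 + ε) ≤ K * (1 - ε / 16) * n.choose k := by
    have h1 : (N : ℝ) * (1 + ε) ≤ W * (1 - ε / 16) := by
      rw [le_div_iff₀ (by positivity)] at hN_le
      have h2 : 1 + ε ≤ (1 + 2 * ε) * (1 - ε / 16) := by
        linarith [mul_nonneg hε.le (sub_nonneg.2 hε'.le)]
      calc (N : ℝ) * (1 + ε) ≤ N * ((1 + 2 * ε) * (1 - ε / 16)) := by gcongr
        _ = N * (1 + 2 * ε) * (1 - ε / 16) := by ring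
        _ ≤ _ := by
          gcongr
          linarith
    calc (N : ℝ) * ν ^ 2 * (1 + ε) = N * (1 + ε) * ν ^ 2 := by ring
      _ ≤ W * (1 - ε / 16) * ν ^ 2 := by gcongr
      _ = _ := by rw [hW]; field_simp
  refine ⟨N, K, hK0, hNK, hexpK, hMε, hthin, ?_⟩
  have hr : (1 - 5 * ε) * M ≤ (⌊(1 - 4 * ε) * M⌋₊ : ℝ) := by
    have := (Nat.sub_one_lt_floor ((1 - 4 * ε) * M)).le
    have h1 : M * ε ^ 2 ≤ M * ε := by
      gcongr
      exact pow_le_of_le_one hε.le hε1 two_ne_zero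
    linarith
  have hN' : (1 - ε) * (W / (1 + 2 * ε)) ≤ N := by
    refine le_trans ?_ hN_ge
    have : 1 ≤ ε * (W / (1 + 2 * ε)) := by
      rw [← mul_div_assoc, le_div_iff₀ (by positivity)]
      linarith [mul_le_mul_of_nonneg_left hKW hε.le]
    linarith
  -- `M` matchings from each of `W` orderings would use every edge: the product is m/ν. The
  -- remaining losses are ε (rounding `N`), 2ε (from 1 + 2ε) and 5ε (the factor 1 - 4ε and
  -- rounding), which total 8ε.
  have hMW : M * W = p * n.choose k / ν := by
    rw [hM, hW]
    field_simp
  have hM0 : 0 ≤ M := by positivity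
  have hW0 : 0 ≤ W := by positivity
  have hfrac : 1 - 2 * ε ≤ 1 / (1 + 2 * ε) := by
    rw [le_div_iff₀ (by positivity)]; linarith [sq_nonneg ε]
  calc (1 - 8 * ε) * (p * n.choose k) / ν = (1 - 8 * ε) * (M * W) := by rw [hMW]; ring
    _ ≤ ((1 - ε) * (1 - 5 * ε) * (1 - 2 * ε)) * (M * W) := by
        gcongr
        linarith [mul_nonneg (sq_nonneg ε) (by linarith : (0 : ℝ) ≤ 17 - 10 * ε)]
    _ ≤ ((1 - ε) * (1 - 5 * ε) * (1 / (1 + 2 * ε))) * (M * W) := by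
        gcongr
        exact mul_nonneg (by linarith) (by linarith)
    _ = ((1 - ε) * (W / (1 + 2 * ε))) * ((1 - 5 * ε) * M) := by ring
    _ ≤ N * (⌊(1 - 4 * ε) * M⌋₊ : ℝ) := by
        gcongr
        exact mul_nonneg (by linarith) hM0

/-- Quantitative form of the packing theorem. -/
theorem exists_hamilton_packing_of_large {a b ν : ℕ} (ha : 0 < a) (hb : 0 < b)
    (E : Finset (Finset (Fin (ν * (a + b)))))
    (hE : (E : Set (Finset (Fin (ν * (a + b))))).Sized (2 * a + b))
    {ε p L A B : ℝ} (hp : p = density (2 * a + b) E) (hε : 0 < ε) (hε' : ε < 1 / 8)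
    (hL : L = Real.log (ν * (a + b) : ℕ)) (hL1 : 1 ≤ L)
    (hB : B = 8 * (2 * a + b : ℕ) + 9) (hBn : B ≤ (ν * (a + b) : ℕ))
    (hn : 64 * (2 * a + b) ≤ ν * (a + b))
    (hA1 : 131072 * (a + b : ℝ) ^ 2 * (2 * (2 * a + b : ℕ) + 2) ≤ A)
    (hA2 : 16 * (a + b : ℝ) * B ≤ A)
    (hA3 : 8192 * (a + b : ℝ) * B ^ 2 * ((2 * a + b : ℕ) + 5) ≤ A)
    (hA : A * L ^ 6 ≤ (ν * (a + b) : ℕ) * p ^ 4 * ε ^ 10)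
    (hP : PseudoRandom (2 * a + b) (a + b) ε E) :
    ∃ 𝒞 : Finset (Finset (Finset (Fin (ν * (a + b))))),
      (∀ C ∈ 𝒞, IsHamiltonCycle (2 * a + b) (a + b) E C) ∧
      (∀ C ∈ 𝒞, ∀ C' ∈ 𝒞, C ≠ C' → Disjoint C C') ∧
      (1 - 8 * ε) * (E.card : ℝ) / ν ≤ 𝒞.card := by
  have hk : 2 * a + b ≤ ν * (a + b) := by omega
  have hν : 3 ≤ ν := by
    by_contra h
    have : ν * (a + b) ≤ 2 * (a + b) := Nat.mul_le_mul_right _ (by omega)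
    omega
  have hp0 : 0 ≤ p := hp ▸ density_nonneg _ _
  have hp1 : p ≤ 1 := hp ▸ density_le_one hE
  have hn64 : (64 : ℝ) ≤ (ν * (a + b) : ℕ) := by exact_mod_cast (by omega : 64 ≤ ν * (a + b))
  have hνpos : (0 : ℝ) < ν := by exact_mod_cast (by omega : 0 < ν)
  have ha1 : (1 : ℝ) ≤ a := by exact_mod_cast ha
  have hb1 : (1 : ℝ) ≤ b := by exact_mod_cast hb
  have hℓ0 : (0 : ℝ) < (a : ℝ) + b := by positivity
  have hnν : ((ν * (a + b) : ℕ) : ℝ) = ν * ((a : ℝ) + b) := by push_cast; ring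
  have hch : (0 : ℝ) < (ν * (a + b)).choose (2 * a + b) := by exact_mod_cast Nat.choose_pos hk
  have hA64 : 64 * ((a : ℝ) * b) ≤ A := by
    refine le_trans ?_ hA1
    have h1 : (a : ℝ) * b ≤ (a + b : ℝ) ^ 2 := by nlinarith
    have h2 : (a + b : ℝ) ^ 2 ≤ (a + b : ℝ) ^ 2 * (2 * (2 * a + b : ℕ) + 2) :=
      le_mul_of_one_le_right (by positivity) (by push_cast; linarith)
    nlinarith
  have hA0 : 1 ≤ A := by nlinarith
  have hab : (2 * a * b : ℝ) ≤ ε / 32 * (ν * (a + b) : ℕ) := by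
    have := le_mul_pow_mul_pow_of_le (by positivity) (by linarith) hL1 hp0 hp1 hε.le (by linarith)
      hA 0 0 1 (by norm_num) (by norm_num) (by norm_num)
    simp only [pow_zero, mul_one, pow_one] at this
    linarith
  have hbad := failure_probability_le hn64 hℓ0 hnν hp0 hp1 hε (by linarith) hL hL1 hA0 hA1 hA
  obtain ⟨N, K, hK0, hNK, hexpK, hMε, hthin, hcount⟩ := exists_packing_parameters hn64 hνpos hℓ0
    hnν (sq_le_choose ha hb hν) hp0 hp1 hε hε' hL hL1 hB hBn hA0 hA2 hA3 hA
  obtain ⟨𝒞, h1, h2, h3⟩ := exists_hamilton_packing ha hb hν hk E hE hp hε hε'.le hab hP hbad N K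
    hK0 hNK hexpK hMε hthin
  refine ⟨𝒞, h1, h2, ?_⟩
  have hcard : (E.card : ℝ) = p * (ν * (a + b)).choose (2 * a + b) := by
    rw [hp, density, div_mul_cancel₀ _ hch.ne']
  rw [h3, hcard]
  push_cast at hcount ⊢
  exact hcount

end HypergraphPacking

/-! ### The asymptotic theorem. -/

open HypergraphPacking
theorem theorem3 (k ℓ : ℕ) (hkℓ : k < 2 * ℓ) (hℓk : ℓ < k)
    (n : ℕ → ℕ) (hn : Tendsto n atTop atTop) (hdvd : ∀ t, ℓ ∣ n t)
    (E : ∀ t, Finset (Finset (Fin (n t))))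
    (hunif : ∀ t, (E t : Set (Finset (Fin (n t)))).Sized k)
    (ε : ℕ → ℝ) (hε₀ : ∀ t, 0 < ε t) (hε₁ : ∀ t, ε t ^ 5 < 1)
    (hε : Tendsto
      (fun t => ε t ^ 5 /
        (Real.log (n t : ℝ) ^ 3 / ((n t : ℝ) ^ (1 / 2 : ℝ) * density k (E t) ^ 2)))
      atTop atTop)
    (hP : ∀ t, PseudoRandom k ℓ (ε t) (E t)) :
    ∀ᶠ t in atTop, ∃ 𝒞 : Finset (Finset (Finset (Fin (n t)))),
      (∀ C ∈ 𝒞, IsHamiltonCycle k ℓ (E t) C) ∧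
      (∀ C ∈ 𝒞, ∀ C' ∈ 𝒞, C ≠ C' → Disjoint C C') ∧
      (1 - 2 * ε t ^ (1 / 3 : ℝ)) * ((E t).card : ℝ) / ((n t : ℝ) / (ℓ : ℝ)) ≤ (𝒞.card : ℝ) := by
  obtain ⟨a, b, rfl, rfl⟩ : ∃ a b, ℓ = a + b ∧ k = 2 * a + b :=
    ⟨k - ℓ, 2 * ℓ - k, by omega, by omega⟩
  have ha : 0 < a := by omega
  have hb : 0 < b := by omega
  set B : ℝ := 8 * (2 * a + b : ℕ) + 9 with hB
  obtain ⟨A, hA⟩ : ∃ A : ℝ, 131072 * (a + b : ℝ) ^ 2 * (2 * (2 * a + b : ℕ) + 2) ≤ A ∧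
      16 * (a + b : ℝ) * B ≤ A ∧ 8192 * (a + b : ℝ) * B ^ 2 * ((2 * a + b : ℕ) + 5) ≤ A :=
    ⟨max _ (max _ _), le_max_left _ _, (le_max_left _ _).trans (le_max_right _ _),
      (le_max_right _ _).trans (le_max_right _ _)⟩
  have hlarge : ∀ᶠ t in atTop, max (64 * (2 * a + b)) ⌈B⌉₊ ≤ n t := hn.eventually_ge_atTop _
  filter_upwards [hlarge, hε.eventually_ge_atTop (max A 1)] with t ht htA
  obtain ⟨ht1, ht2⟩ := max_le_iff.1 ht
  -- For ε ≥ 1/8 the factor 1 - 2ε^(1/3) is at most 0, and the empty collection suffices.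
  rcases le_or_gt (1 / 8) (ε t) with h8 | h8
  · refine ⟨∅, by simp, by simp, ?_⟩
    have h1 : (1 / 2 : ℝ) ≤ ε t ^ (1 / 3 : ℝ) := by
      calc (1 / 2 : ℝ) = (1 / 8 : ℝ) ^ (1 / 3 : ℝ) := by
            rw [show (1 / 8 : ℝ) = (1 / 2) ^ (3 : ℝ) by norm_num, ← Real.rpow_mul (by norm_num)]
            norm_num
        _ ≤ _ := Real.rpow_le_rpow (by norm_num) h8 (by norm_num)
    rw [Finset.card_empty, Nat.cast_zero]
    refine div_nonpos_of_nonpos_of_nonneg (mul_nonpos_of_nonpos_of_nonneg (by linarith) ?_) ?_ <;>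
      positivity
  -- With y = ε^(1/3) this reads 8y³ ≤ 2y, which holds as y ≤ 1/2.
  · have h1 : 8 * ε t ≤ 2 * ε t ^ (1 / 3 : ℝ) := by
      set y := ε t ^ (1 / 3 : ℝ) with hy
      have hy0 : 0 ≤ y := Real.rpow_nonneg (hε₀ t).le _
      have hy3 : y ^ 3 = ε t := by
        rw [hy, ← Real.rpow_natCast, ← Real.rpow_mul (hε₀ t).le]; norm_num
      have hy2 : y ≤ 1 / 2 := by
        by_contra! h
        have : (1 / 2 : ℝ) ^ 3 < y ^ 3 := by gcongr
        norm_num at this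
        linarith
      rw [← hy3]
      nlinarith [mul_nonneg hy0 (sub_nonneg.2 hy2), mul_nonneg hy0 hy0]
    have hnt : (64 : ℝ) ≤ n t := by exact_mod_cast (by omega : 64 ≤ n t)
    have hL1 : 1 ≤ Real.log (n t) := by
      rw [Real.le_log_iff_exp_le (by linarith)]
      have := Real.exp_one_lt_d9
      linarith
    have hε' := hε₀ t
    have hdens : 0 ≤ density (2 * a + b) (E t) := density_nonneg _ _
    -- The growth hypothesis squared. Using max A 1 in place of `A` ensures that squaring the
    -- constant does not make it smaller than `A`.
    have hmain : A * Real.log (n t) ^ 6 ≤ n t * density (2 * a + b) (E t) ^ 4 * ε t ^ 10 := by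
      set L := Real.log (n t)
      set p := density (2 * a + b) (E t)
      set x := (n t : ℝ) ^ (1 / 2 : ℝ) with hx
      have hx0 : 0 < x := Real.rpow_pos_of_pos (by linarith) _
      have hx2 : x ^ 2 = n t := by
        rw [hx, ← Real.rpow_natCast, ← Real.rpow_mul (by linarith)]; norm_num
      have hA1 : 1 ≤ max A 1 := le_max_right _ _
      have h2 : max A 1 * L ^ 3 ≤ x * p ^ 2 * ε t ^ 5 := by
        -- Only log n > 0 is needed here: the rewriting of the iterated quotient is valid even when
        -- the density is 0.
        rw [div_div_eq_mul_div, le_div_iff₀ (by positivity)] at htA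
        linarith
      have h3 : (max A 1 * L ^ 3) ^ 2 ≤ (x * p ^ 2 * ε t ^ 5) ^ 2 := by gcongr
      calc A * L ^ 6 ≤ max A 1 * L ^ 6 := by gcongr; exact le_max_left _ _
        _ ≤ (max A 1 * max A 1) * L ^ 6 := by
            gcongr; exact le_mul_of_one_le_left (by linarith) hA1
        _ = (max A 1 * L ^ 3) ^ 2 := by ring
        _ ≤ _ := h3
        _ = x ^ 2 * p ^ 4 * ε t ^ 10 := by ring
        _ = _ := by rw [hx2]
    obtain ⟨ν, hν⟩ := hdvd t
    rw [mul_comm] at hν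
    have hEt := hunif t
    have hPt := hP t
    have hBn : B ≤ n t := Nat.ceil_le.1 ht2
    -- Makes the vertex number a variable, so that n = νℓ can be substituted in the type of the
    -- hypergraph.
    generalize E t = F at *
    generalize n t = m at *
    subst hν
    obtain ⟨𝒞, c1, c2, c3⟩ := exists_hamilton_packing_of_large ha hb F hEt rfl hε' h8 rfl hL1 hB hBn
      ht1 hA.1 hA.2.1 hA.2.2 hmain hPt
    refine ⟨𝒞, c1, c2, le_trans ?_ c3⟩
    have hab : ((a + b : ℕ) : ℝ) ≠ 0 := by exact_mod_cast (by omega : a + b ≠ 0)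
    rw [Nat.cast_mul, mul_div_cancel_right₀ _ hab]
    gcongr
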